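/- **Setting.** Let $M$ be a smooth real manifold of finite dimension $n$, and let $\mathbb{T}M=TM\oplus T^*M$ carry the inner product $\langle X+\alpha,Y+\beta\rangle=\tfrac12(\alpha(Y)+\beta(X))$ and the Dorfman bracket $[X+\alpha,Y+\beta]=[X,Y]+\mathcal L_X\beta-\iota_Y d\alpha$; both are extended complex-bilinearly to $\mathbb{T}M\otimes\mathbb{C}$. A *split structure* of rank $2k$ is a smooth subbundle $E\subseteq\mathbb{T}M$ of rank $2k$ on which $\langle\,,\rangle$ is nondegenerate of signature $(k,k)$. A *framing* of $E$ over an open set $U$ is a real subspace $V\subseteq\Gamma_U(E)$ of dimension $2k$ whose $C^\infty(U)$-span is $\Gamma_U(E)$ (a framing of $E$ if $U=M$). $\mathrm{SGF}(E)$ is the set of smooth bundle endomorphisms $J$ of $E$ that are skew-symmetric and orthogonal with respect to $\langle\,,\rangle$; put $L_J=\{x-\sqrt{-1}\,Jx : x\in E\}\subseteq E\otimes\mathbb{C}$. Such a $J$ is a (split) *generalized CRF-structure* on $E$ if $\Gamma(L_J)$ is closed under the Dorfman bracket. For a (real or complex) subbundle $S$, $\mathbb{I}_U(S)$ is the set of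 sections $x$ over $U$ with $[x,\Gamma_U(S)]\subseteq\Gamma_U(S)$; write $\mathbb{I}(S)=\mathbb{I}_M(S)$ and $\mathbb{I}(J)=\mathbb{I}(L_J)$. If $E'$ is a split structure orthogonal to $E$, $J\in\mathrm{SGF}(E)$ and $V$ is a framing of $E'$, then $(J,V)$ is a *normal pair* if $J$ is a generalized CRF-structure on $E$ and $V\subseteq\mathbb{I}(J)\cap\mathbb{I}(E')$. A *Morimoto datum* $\mathcal M=(J_1,J_2,V_1,V_2,\Psi)$ consists of pairwise orthogonal split structures $E_1,E_2,E_1',E_2'$ on $M$, structures $J_i\in\mathrm{SGF}(E_i)$, framings $V_i$ of $E_i'$ ($i=1,2$), and $\Psi\in\mathrm{SGF}(E_1'\oplus E_2')$ such that, with $E_i''=E_i\oplus E_i'$: 1. $V_i\subseteq\mathbb{I}(E_1'')\cap\mathbb{I}(E_2'')$ for $i=1,2$; 2. for $i=1,2$, every point of $M$ has an open neighbourhood $U$ over which there is a framing $W_i\subseteq\mathbb{I}_U(E_1'')\cap\mathbb{I}_U(E_2'')$ of $E_i$; 3. $(V_1,V_2,\Psi)$ is *admissible*: there is an isomorphism $\phi:\Gamma(E_1'\otimes\mathbb{C})\to\Gamma(E_2'\otimes\mathbb{C})$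 of $C^\infty(M,\mathbb{C})$-modules such that $\phi(V_1\otimes\mathbb{C})=V_2\otimes\mathbb{C}$ and $\Gamma(L_\Psi)=\{e+\phi(e): e\in\Gamma(E_1'\otimes\mathbb{C})\}$. $\mathcal M$ is *adaptable* if for $i=1,2$ every point of $M$ has an open neighbourhood $U$ over which there is a framing $W_i$ as in 2 that also satisfies $d\langle J_i w,z\rangle\in\Gamma_U(E_i'')$ for all $w,z\in W_i$. **Theorem (Abstract Morimoto Theorem).** Let $\mathcal M=(J_1,J_2,V_1,V_2,\Psi)$ be a Morimoto datum on $M$. The following are equivalent: (a) $J=J_1\oplus J_2\oplus\Psi$ is a generalized CRF-structure on $E_1''\oplus E_2''$, and $\mathcal M$ is adaptable; (b) $(J_1,V_1)$ and $(J_2,V_2)$ are normal pairs, and $\Psi$ is a generalized CRF-structure on $E_1'\oplus E_2'$. -/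

import Mathlib

open scoped Manifold ContDiff TensorProduct Bundle
open TopologicalSpace (Opens)

noncomputable section

namespace GenGeom

/-! ## The generalized tangent bundle

`M` is a smooth manifold without boundary modelled on a real vector space `F`
(finite-dimensional in the theorem). -/

section Basic

variable (F : Type*) [NormedAddCommGroup F] [NormedSpace ℝ F]
  {M : Type*} [TopologicalSpace M] [ChartedSpace F M]

/-- The fibre `T_p M ⊕ T_p^* M` of the generalized tangent bundle. -/
abbrev GT (p : M) : Type _ :=
  TangentSpace 𝓘(ℝ, F) p × (TangentSpace 𝓘(ℝ, F) p →L[ℝ] ℝ)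

/-- The fibre of the complexified generalized tangent bundle. -/
abbrev CGT (p : M) : Type _ := ℂ ⊗[ℝ] GT F p

variable {F}

/-- The tautological inner product `⟨X + α, Y + β⟩ = (α(Y) + β(X)) / 2` at a point. -/
def pair {p : M} (x y : GT F p) : ℝ := (x.2 y.1 + y.2 x.1) / 2

lemma pair_comm {p : M} (x y : GT F p) : pair x y = pair y x := by
  simp only [pair]; ring

lemma pair_add_left {p : M} (x y z : GT F p) : pair (x + y) z = pair x z + pair y z := by
  simp only [pair, Prod.fst_add, Prod.snd_add, add_apply, map_add]; ring

lemma pair_smul_left {p : M} (c : ℝ) (x z : GT F p) : pair (c • x) z = c * pair x z := by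
  simp only [pair, Prod.smul_fst, Prod.smul_snd, smul_apply, map_smul,
    smul_eq_mul]; ring

lemma pair_add_right {p : M} (x y z : GT F p) : pair x (y + z) = pair x y + pair x z := by
  rw [pair_comm, pair_add_left, pair_comm y, pair_comm z]

lemma pair_zero_left {p : M} (z : GT F p) : pair 0 z = 0 := by
  simp [pair]

/-- The differential `df`, as a section of `T^*M ⊆ 𝕋M`. -/
def dSection (f : M → ℝ) (p : M) : GT F p := (0, mvfderiv 𝓘(ℝ, F) f p)

/-- `ι_v dα` at `p`, where `dα` is the exterior derivative of the one-form `α`, computed in the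
preferred chart `φ` at `p`: if `a` is the local representative of `α` in this chart, then
`dα(v, w) = (D a)(dφ v)(dφ w) - (D a)(dφ w)(dφ v)`. -/
def contractExtDeriv (α : (q : M) → TangentSpace 𝓘(ℝ, F) q →L[ℝ] ℝ) (p : M)
    (v : TangentSpace 𝓘(ℝ, F) p) : TangentSpace 𝓘(ℝ, F) p →L[ℝ] ℝ :=
  let φ := extChartAt 𝓘(ℝ, F) p
  let a : F → F →L[ℝ] ℝ := fun u => (α (φ.symm u)).comp (mfderiv 𝓘(ℝ, F) 𝓘(ℝ, F) φ.symm u)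
  let D : F →L[ℝ] F →L[ℝ] ℝ := fderiv ℝ a (φ p)
  let T : TangentSpace 𝓘(ℝ, F) p →L[ℝ] F := mfderiv 𝓘(ℝ, F) 𝓘(ℝ, F) φ p
  (D (T v)).comp T - (D.flip (T v)).comp T

/-- The Lie derivative of a one-form `β` along a vector field `X`, by Cartan's formula
`L_X β = d(β(X)) + ι_X dβ`. -/
def lieDerivForm (X : (q : M) → TangentSpace 𝓘(ℝ, F) q)
    (β : (q : M) → TangentSpace 𝓘(ℝ, F) q →L[ℝ] ℝ) (p : M) : TangentSpace 𝓘(ℝ, F) p →L[ℝ] ℝ :=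
  mvfderiv 𝓘(ℝ, F) (fun q => β q (X q)) p + contractExtDeriv β p (X p)

/-- The Dorfman bracket `[X + α, Y + β] = [X, Y] + L_X β - ι_Y dα`. -/
def dorfman (x y : (q : M) → GT F q) (p : M) : GT F p :=
  (VectorField.mlieBracket 𝓘(ℝ, F) (fun q => (x q).1) (fun q => (y q).1) p,
    lieDerivForm (fun q => (x q).1) (fun q => (y q).2) p
      - contractExtDeriv (fun q => (x q).2) p (y p).1)

/-- The real part `x` of the element `x + i y` of the complexified fibre. -/
def reC {p : M} : CGT F p →ₗ[ℝ] GT F p :=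
  (TensorProduct.lid ℝ (GT F p)).toLinearMap ∘ₗ LinearMap.rTensor (GT F p) Complex.reLm

/-- The imaginary part `y` of the element `x + i y` of the complexified fibre. -/
def imC {p : M} : CGT F p →ₗ[ℝ] GT F p :=
  (TensorProduct.lid ℝ (GT F p)).toLinearMap ∘ₗ LinearMap.rTensor (GT F p) Complex.imLm

/-- The element `x + i y` of the complexified fibre. -/
def mkC {p : M} (x y : GT F p) : CGT F p := (1 : ℂ) ⊗ₜ[ℝ] x + Complex.I ⊗ₜ[ℝ] y

/-- The complex bilinear extension of the Dorfman bracket. -/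
def dorfmanC (z w : (q : M) → CGT F q) (p : M) : CGT F p :=
  mkC (dorfman (fun q => reC (z q)) (fun q => reC (w q)) p
        - dorfman (fun q => imC (z q)) (fun q => imC (w q)) p)
      (dorfman (fun q => reC (z q)) (fun q => imC (w q)) p
        + dorfman (fun q => imC (z q)) (fun q => reC (w q)) p)

@[simp] lemma reC_tmul {p : M} (c : ℂ) (x : GT F p) : reC (c ⊗ₜ[ℝ] x) = c.re • x := by
  simp [reC]

@[simp] lemma imC_tmul {p : M} (c : ℂ) (x : GT F p) : imC (c ⊗ₜ[ℝ] x) = c.im • x := by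
  simp [imC]

@[simp] lemma reC_mkC {p : M} (x y : GT F p) : reC (mkC x y) = x := by
  simp [mkC]

@[simp] lemma imC_mkC {p : M} (x y : GT F p) : imC (mkC x y) = y := by
  simp [mkC]

lemma mkC_add {p : M} (x y x' y' : GT F p) :
    mkC (x + x') (y + y') = mkC x y + mkC x' y' := by
  simp only [mkC, TensorProduct.tmul_add]; abel

lemma mkC_reC_imC {p : M} (z : CGT F p) : mkC (reC z) (imC z) = z := by
  induction z using TensorProduct.induction_on with
  | zero => simp [mkC]
  | tmul c x =>
    simp only [mkC, reC_tmul, imC_tmul]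
    rw [← TensorProduct.smul_tmul, ← TensorProduct.smul_tmul, ← TensorProduct.add_tmul]
    congr 1
    apply Complex.ext <;> simp
  | add a b ha hb =>
    rw [map_add, map_add, mkC_add, ha, hb]

lemma reC_smul {p : M} (c : ℂ) (z : CGT F p) :
    reC (c • z) = c.re • reC z - c.im • imC z := by
  induction z using TensorProduct.induction_on with
  | zero => simp
  | tmul d x =>
    simp only [TensorProduct.smul_tmul', reC_tmul, imC_tmul, smul_eq_mul, Complex.mul_re]
    module
  | add a b ha hb => simp only [smul_add, map_add, ha, hb]; abel

lemma imC_smul {p : M} (c : ℂ) (z : CGT F p) :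
    imC (c • z) = c.re • imC z + c.im • reC z := by
  induction z using TensorProduct.induction_on with
  | zero => simp
  | tmul d x =>
    simp only [TensorProduct.smul_tmul', reC_tmul, imC_tmul, smul_eq_mul, Complex.mul_im]
    module
  | add a b ha hb => simp only [smul_add, map_add, ha, hb]; abel

end Basic

/-! ## Smooth sections -/

section Sections

variable {F : Type*} [NormedAddCommGroup F] [NormedSpace ℝ F]
  {M : Type*} [TopologicalSpace M] [ChartedSpace F M] [IsManifold 𝓘(ℝ, F) ∞ M]

/-- Smoothness on `U` of a section of `TM ⊕ T^*M`: both components are smooth. -/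
def IsSmoothOn (U : Opens M) (x : (p : M) → GT F p) : Prop :=
  ContMDiffOn 𝓘(ℝ, F) (𝓘(ℝ, F).prod 𝓘(ℝ, F)) ∞
      (fun p => (⟨p, (x p).1⟩ : TangentBundle 𝓘(ℝ, F) M)) U ∧
    ContMDiffOn 𝓘(ℝ, F) (𝓘(ℝ, F).prod 𝓘(ℝ, F →L[ℝ] ℝ)) ∞
      (fun p => Bundle.TotalSpace.mk' (F →L[ℝ] ℝ)
        (E := fun q : M => TangentSpace 𝓘(ℝ, F) q →L[ℝ] Bundle.Trivial M ℝ q) p (x p).2) U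

lemma IsSmoothOn.add {U : Opens M} {x y : (p : M) → GT F p} (hx : IsSmoothOn U x)
    (hy : IsSmoothOn U y) : IsSmoothOn U (x + y) :=
  ⟨hx.1.add_section hy.1, hx.2.add_section hy.2⟩

lemma IsSmoothOn.sub {U : Opens M} {x y : (p : M) → GT F p} (hx : IsSmoothOn U x)
    (hy : IsSmoothOn U y) : IsSmoothOn U (x - y) :=
  ⟨hx.1.sub_section hy.1, hx.2.sub_section hy.2⟩

lemma IsSmoothOn.smul {U : Opens M} {f : M → ℝ} {x : (p : M) → GT F p}
    (hf : ContMDiffOn 𝓘(ℝ, F) 𝓘(ℝ, ℝ) ∞ f U) (hx : IsSmoothOn U x) :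
    IsSmoothOn U (fun p => f p • x p) :=
  ⟨hf.smul_section hx.1, hf.smul_section hx.2⟩

lemma IsSmoothOn.mono {U V : Opens M} {x : (p : M) → GT F p} (hx : IsSmoothOn U x)
    (h : V ≤ U) : IsSmoothOn V x :=
  ⟨hx.1.mono h, hx.2.mono h⟩

lemma IsSmoothOn.zero {U : Opens M} : IsSmoothOn U (0 : (p : M) → GT F p) :=
  ⟨(Bundle.contMDiff_zeroSection ℝ (fun q : M => TangentSpace 𝓘(ℝ, F) q)).contMDiffOn,
    (Bundle.contMDiff_zeroSection ℝ
      (fun q : M => TangentSpace 𝓘(ℝ, F) q →L[ℝ] Bundle.Trivial M ℝ q)).contMDiffOn⟩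

variable (F) in
/-- The ring of `𝕜`-valued functions that are smooth on `U`. -/
def smoothRing (𝕜 : Type*) [RCLike 𝕜] (U : Opens M) : Subring (M → 𝕜) where
  carrier := {f | ContMDiffOn 𝓘(ℝ, F) 𝓘(ℝ, 𝕜) ∞ f U}
  mul_mem' hf hg := contDiff_mul.contMDiff.comp_contMDiffOn (ContMDiffOn.prodMk_space hf hg)
  one_mem' := contMDiffOn_const
  add_mem' hf hg := ContMDiffOn.add hf hg
  zero_mem' := contMDiffOn_const
  neg_mem' hf := ContMDiffOn.neg hf

/-- The module `Γ_U(E)` of smooth sections over `U` of a family `E` of subspaces. A section over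
`U` is represented by the function on `M` that extends it by zero. -/
def sections (U : Opens M) (E : (p : M) → Submodule ℝ (GT F p)) :
    Submodule (smoothRing F ℝ U) ((p : M) → GT F p) where
  carrier := {x | IsSmoothOn U x ∧ (∀ p ∈ U, x p ∈ E p) ∧ ∀ p ∉ U, x p = 0}
  add_mem' {x y} hx hy := ⟨hx.1.add hy.1, fun p hp => (E p).add_mem (hx.2.1 p hp) (hy.2.1 p hp),
    fun p hp => by simp [hx.2.2 p hp, hy.2.2 p hp]⟩
  zero_mem' := ⟨IsSmoothOn.zero, fun p _ => (E p).zero_mem, fun _ _ => rfl⟩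
  smul_mem' f x hx := ⟨IsSmoothOn.smul f.2 hx.1, fun p hp => (E p).smul_mem _ (hx.2.1 p hp),
    fun p hp => by
      change (f : M → ℝ) p • x p = 0
      rw [hx.2.2 p hp, smul_zero]⟩

/-- The `C^∞(M, ℂ)`-module `Γ(E ⊗ ℂ)` of global smooth sections of the complexification of `E`:
the `x + i y` with `x, y ∈ Γ(E)`. -/
def sectionsC (E : (p : M) → Submodule ℝ (GT F p)) :
    Submodule (smoothRing F ℂ (⊤ : Opens M)) ((p : M) → CGT F p) where
  carrier := {z | (fun p => reC (z p)) ∈ sections ⊤ E ∧ (fun p => imC (z p)) ∈ sections ⊤ E}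
  add_mem' {z w} hz hw := by
    have h : (fun p => reC ((z + w) p)) = (fun p => reC (z p)) + fun p => reC (w p) := by
      ext1 p; simp
    have h' : (fun p => imC ((z + w) p)) = (fun p => imC (z p)) + fun p => imC (w p) := by
      ext1 p; simp
    rw [Set.mem_ofPred_eq, h, h']
    exact ⟨add_mem hz.1 hw.1, add_mem hz.2 hw.2⟩
  zero_mem' := by
    have h : (fun p => reC ((0 : (p : M) → CGT F p) p)) = 0 := by ext1 p; simp
    have h' : (fun p => imC ((0 : (p : M) → CGT F p) p)) = 0 := by ext1 p; simp
    rw [Set.mem_ofPred_eq, h, h']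
    exact ⟨zero_mem _, zero_mem _⟩
  smul_mem' f z hz := by
    have hre : (fun p => ((f : M → ℂ) p).re) ∈ smoothRing F ℝ (⊤ : Opens M) :=
      Complex.reCLM.contDiff.contMDiff.comp_contMDiffOn f.2
    have him : (fun p => ((f : M → ℂ) p).im) ∈ smoothRing F ℝ (⊤ : Opens M) :=
      Complex.imCLM.contDiff.contMDiff.comp_contMDiffOn f.2
    have h : (fun p => reC ((f • z) p)) =
        (fun p => ((f : M → ℂ) p).re • reC (z p)) - fun p => ((f : M → ℂ) p).im • imC (z p) := by
      ext1 p; exact reC_smul _ _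
    have h' : (fun p => imC ((f • z) p)) =
        (fun p => ((f : M → ℂ) p).re • imC (z p)) + fun p => ((f : M → ℂ) p).im • reC (z p) := by
      ext1 p; exact imC_smul _ _
    rw [Set.mem_ofPred_eq, h, h']
    exact ⟨sub_mem (Submodule.smul_mem _ ⟨_, hre⟩ hz.1) (Submodule.smul_mem _ ⟨_, him⟩ hz.2),
      add_mem (Submodule.smul_mem _ ⟨_, hre⟩ hz.2) (Submodule.smul_mem _ ⟨_, him⟩ hz.1)⟩

end Sections

/-! ## Split structures -/

section Split

variable {F : Type*} [NormedAddCommGroup F] [NormedSpace ℝ F]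
  {M : Type*} [TopologicalSpace M] [ChartedSpace F M] [IsManifold 𝓘(ℝ, F) ∞ M]

/-- `E` is a smooth subbundle of rank `r` of the generalized tangent bundle: it has local smooth
frames of length `r`. -/
def IsSubbundle (r : ℕ) (E : (p : M) → Submodule ℝ (GT F p)) : Prop :=
  ∀ p : M, ∃ U : Opens M, p ∈ U ∧ ∃ s : Fin r → (q : M) → GT F q,
    (∀ i, IsSmoothOn U (s i)) ∧ ∀ q ∈ U, LinearIndependent ℝ (fun i => s i q) ∧
      Submodule.span ℝ (Set.range fun i => s i q) = E q

/-- The tautological inner product restricted to `E ⊆ 𝕋_p M` is nondegenerate of signature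
`(k, k)`: there is a pseudo-orthonormal basis `e₁, …, e_k, f₁, …, f_k` of `E` with
`⟨e_i, e_i⟩ = 1` and `⟨f_i, f_i⟩ = -1`. (Linear independence follows from these relations.) -/
def HasSplitSignature (k : ℕ) {p : M} (E : Submodule ℝ (GT F p)) : Prop :=
  ∃ e f : Fin k → GT F p, Submodule.span ℝ (Set.range e ∪ Set.range f) = E ∧
    (∀ i j, pair (e i) (e j) = if i = j then 1 else 0) ∧
    (∀ i j, pair (f i) (f j) = if i = j then -1 else 0) ∧
    ∀ i j, pair (e i) (f j) = 0

variable (F M) in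
/-- A split structure of rank `2k`. -/
structure SplitStructure where
  fiber : (p : M) → Submodule ℝ (GT F p)
  halfRank : ℕ
  isSubbundle : IsSubbundle (2 * halfRank) fiber
  signature : ∀ p, HasSplitSignature halfRank (fiber p)

/-- `⟨A, B⟩ = 0`. -/
def SplitStructure.Orthogonal (A B : SplitStructure F M) : Prop :=
  ∀ p, ∀ x ∈ A.fiber p, ∀ y ∈ B.fiber p, pair x y = 0

lemma SplitStructure.Orthogonal.symm {A B : SplitStructure F M} (h : A.Orthogonal B) :
    B.Orthogonal A := fun p x hx y hy => by rw [pair_comm]; exact h p y hy x hx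

/-- A split structure is nondegenerate. -/
lemma SplitStructure.eq_zero_of_orthogonal (A : SplitStructure F M) {p : M} {x : GT F p}
    (hx : x ∈ A.fiber p) (h : ∀ y ∈ A.fiber p, pair x y = 0) : x = 0 := by
  obtain ⟨e, f, hs, hee, hff, hef⟩ := A.signature p
  have key : x = ∑ i, pair x (e i) • e i - ∑ i, pair x (f i) • f i := by
    rw [← hs] at hx
    clear h
    induction hx using Submodule.span_induction with
    | mem x hx =>
      rcases hx with ⟨j, rfl⟩ | ⟨j, rfl⟩
      · simp [hee, hef]
      · simp only [hff, pair_comm (f j) (e _), hef, zero_smul, ite_smul, Finset.sum_const_zero,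
          Finset.sum_ite_eq, Finset.mem_univ, if_true]
        module
    | zero => simp [pair_zero_left]
    | add a b _ _ ha hb =>
      simp only [pair_add_left, add_smul, Finset.sum_add_distrib]
      nth_rewrite 1 [ha, hb]; abel
    | smul c a _ ha =>
      simp only [pair_smul_left, mul_smul, ← Finset.smul_sum, ← smul_sub]
      rw [← ha]
  have he : ∀ i, e i ∈ A.fiber p := fun i => hs ▸ Submodule.subset_span (Or.inl ⟨i, rfl⟩)
  have hf : ∀ i, f i ∈ A.fiber p := fun i => hs ▸ Submodule.subset_span (Or.inr ⟨i, rfl⟩)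
  rw [key]
  simp [h _ (he _), h _ (hf _)]

lemma SplitStructure.Orthogonal.disjoint {A B : SplitStructure F M} (h : A.Orthogonal B) (p : M) :
    Disjoint (A.fiber p) (B.fiber p) := by
  rw [Submodule.disjoint_def]
  intro x hA hB
  exact A.eq_zero_of_orthogonal hA fun y hy => h.symm p x hB y hy

/-- The Whitney sum `A ⊕ B` of two orthogonal split structures. -/
def SplitStructure.orthSum (A B : SplitStructure F M) (h : A.Orthogonal B) :
    SplitStructure F M where
  fiber p := A.fiber p ⊔ B.fiber p
  halfRank := A.halfRank + B.halfRank
  isSubbundle p := by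
    obtain ⟨U, hU, s, hs, hsU⟩ := A.isSubbundle p
    obtain ⟨V, hV, t, ht, htV⟩ := B.isSubbundle p
    let φ : Fin (2 * A.halfRank) ⊕ Fin (2 * B.halfRank) ≃
        Fin (2 * (A.halfRank + B.halfRank)) := finSumFinEquiv.trans (finCongr (by ring))
    refine ⟨U ⊓ V, ⟨hU, hV⟩, fun i => Sum.elim s t (φ.symm i), fun i => ?_, fun q hq => ?_⟩
    · change IsSmoothOn (U ⊓ V) (Sum.elim s t (φ.symm i))
      rcases φ.symm i with j | j
      · exact (hs j).mono inf_le_left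
      · exact (ht j).mono inf_le_right
    · have h1 : (fun i => Sum.elim s t (φ.symm i) q) =
          Sum.elim (fun j => s j q) (fun j => t j q) ∘ φ.symm := by
        ext1 i
        simp only [Function.comp]
        rcases φ.symm i with j | j <;> rfl
      rw [h1]
      constructor
      · rw [linearIndependent_equiv]
        refine LinearIndependent.sum_type (hsU q hq.1).1 (htV q hq.2).1 ?_
        rw [(hsU q hq.1).2, (htV q hq.2).2]
        exact h.disjoint q
      · rw [φ.symm.surjective.range_comp, Set.Sum.elim_range, Submodule.span_union,
          (hsU q hq.1).2, (htV q hq.2).2]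
  signature p := by
    obtain ⟨e, f, hs, hee, hff, hef⟩ := A.signature p
    obtain ⟨e', f', hs', hee', hff', hef'⟩ := B.signature p
    have he : ∀ i, e i ∈ A.fiber p := fun i => hs ▸ Submodule.subset_span (Or.inl ⟨i, rfl⟩)
    have hf : ∀ i, f i ∈ A.fiber p := fun i => hs ▸ Submodule.subset_span (Or.inr ⟨i, rfl⟩)
    have he' : ∀ i, e' i ∈ B.fiber p := fun i => hs' ▸ Submodule.subset_span (Or.inl ⟨i, rfl⟩)
    have hf' : ∀ i, f' i ∈ B.fiber p := fun i => hs' ▸ Submodule.subset_span (Or.inr ⟨i, rfl⟩)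
    have hr : ∀ a b : ℕ, ∀ (u : Fin a → GT F p) (v : Fin b → GT F p),
        Set.range (Fin.append u v) = Set.range u ∪ Set.range v := by
      intro a b u v
      ext x
      simp only [Set.mem_range, Set.mem_union]
      constructor
      · rintro ⟨i, rfl⟩
        refine Fin.addCases (fun i => ?_) (fun i => ?_) i
        · exact Or.inl ⟨i, by simp⟩
        · exact Or.inr ⟨i, by simp⟩
      · rintro (⟨i, rfl⟩ | ⟨i, rfl⟩)
        · exact ⟨Fin.castAdd b i, by simp⟩
        · exact ⟨Fin.natAdd a i, by simp⟩
    have hne : ∀ (a b : ℕ) (i : Fin a) (j : Fin b), Fin.castAdd b i ≠ Fin.natAdd a j := by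
      intro a b i j hij
      have := congrArg Fin.val hij
      simp at this
      omega
    have hne' : ∀ (a b : ℕ) (i : Fin a) (j : Fin b), Fin.natAdd a j ≠ Fin.castAdd b i :=
      fun a b i j => (hne a b i j).symm
    refine ⟨Fin.append e e', Fin.append f f', ?_, fun i j => ?_, fun i j => ?_, fun i j => ?_⟩
    · rw [hr, hr, ← hs, ← hs', ← Submodule.span_union]
      congr 1
      ext x
      simp only [Set.mem_union]
      tauto
    · induction i using Fin.addCases <;> induction j using Fin.addCases <;>
        simp [hee, hee', hne, hne', h p _ (he _) _ (he' _), h.symm p _ (he' _) _ (he _)]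
    · induction i using Fin.addCases <;> induction j using Fin.addCases <;>
        simp [hff, hff', hne, hne', h p _ (hf _) _ (hf' _), h.symm p _ (hf' _) _ (hf _)]
    · induction i using Fin.addCases <;> induction j using Fin.addCases <;>
        simp [hef, hef', h p _ (he _) _ (hf' _), h.symm p _ (he' _) _ (hf _)]

end Split

/-! ## Split generalized `F`-structures, normalizers and normal pairs -/

section SGF

variable {F : Type*} [NormedAddCommGroup F] [NormedSpace ℝ F]
  {M : Type*} [TopologicalSpace M] [ChartedSpace F M] [IsManifold 𝓘(ℝ, F) ∞ M]

/-- A split generalized `F`-structure on the split structure `A`: a smooth bundle endomorphism `J`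
of `A` that is skew-symmetric and orthogonal for the tautological inner product. As `A` is
nondegenerate, `𝕋M = A ⊕ A^⊥`, and `J` is stored as its extension by zero on `A^⊥`. -/
structure SGF (A : SplitStructure F M) where
  toFun : (p : M) → GT F p →ₗ[ℝ] GT F p
  mapsTo : ∀ p, ∀ x ∈ A.fiber p, toFun p x ∈ A.fiber p
  extend_zero : ∀ p x, (∀ y ∈ A.fiber p, pair x y = 0) → toFun p x = 0
  skew : ∀ p, ∀ x ∈ A.fiber p, ∀ y ∈ A.fiber p, pair (toFun p x) y = -pair x (toFun p y)
  orthogonal : ∀ p, ∀ x ∈ A.fiber p, ∀ y ∈ A.fiber p, pair (toFun p x) (toFun p y) = pair x y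
  smooth : ∀ (U : Opens M) (x : (p : M) → GT F p), IsSmoothOn U x →
    IsSmoothOn U (fun p => toFun p (x p))

/-- The direct sum `J ⊕ K` on `A ⊕ B`; with extension by zero, this is the pointwise sum. -/
def SGF.orthSum {A B : SplitStructure F M} (J : SGF A) (K : SGF B) (h : A.Orthogonal B) :
    SGF (A.orthSum B h) where
  toFun p := J.toFun p + K.toFun p
  mapsTo p x hx := by
    obtain ⟨a, ha, b, hb, rfl⟩ := Submodule.mem_sup.1 hx
    have e1 := J.extend_zero p b fun y hy => h.symm p b hb y hy
    have e3 := K.extend_zero p a fun y hy => h p a ha y hy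
    simp only [LinearMap.add_apply, map_add, e1, e3, add_zero, zero_add]
    exact Submodule.add_mem_sup (J.mapsTo p a ha) (K.mapsTo p b hb)
  extend_zero p x hx := by
    rw [LinearMap.add_apply, J.extend_zero p x fun y hy => hx y (Submodule.mem_sup_left hy),
      K.extend_zero p x fun y hy => hx y (Submodule.mem_sup_right hy), add_zero]
  skew p x hx y hy := by
    obtain ⟨a, ha, b, hb, rfl⟩ := Submodule.mem_sup.1 hx
    obtain ⟨c, hc, d, hd, rfl⟩ := Submodule.mem_sup.1 hy
    have e1 := J.extend_zero p b fun y hy => h.symm p b hb y hy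
    have e2 := J.extend_zero p d fun y hy => h.symm p d hd y hy
    have e3 := K.extend_zero p a fun y hy => h p a ha y hy
    have e4 := K.extend_zero p c fun y hy => h p c hc y hy
    have e5 := J.skew p a ha c hc
    have e6 := K.skew p b hb d hd
    simp only [LinearMap.add_apply, map_add, e1, e2, e3, e4, add_zero, zero_add, pair_add_left,
      pair_add_right, h p _ (J.mapsTo p a ha) d hd, h.symm p _ (K.mapsTo p b hb) c hc,
      h p a ha _ (K.mapsTo p d hd), h.symm p b hb _ (J.mapsTo p c hc)]
    linarith
  orthogonal p x hx y hy := by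
    obtain ⟨a, ha, b, hb, rfl⟩ := Submodule.mem_sup.1 hx
    obtain ⟨c, hc, d, hd, rfl⟩ := Submodule.mem_sup.1 hy
    have e1 := J.extend_zero p b fun y hy => h.symm p b hb y hy
    have e2 := J.extend_zero p d fun y hy => h.symm p d hd y hy
    have e3 := K.extend_zero p a fun y hy => h p a ha y hy
    have e4 := K.extend_zero p c fun y hy => h p c hc y hy
    have e5 := J.orthogonal p a ha c hc
    have e6 := K.orthogonal p b hb d hd
    simp only [LinearMap.add_apply, map_add, e1, e2, e3, e4, add_zero, zero_add, pair_add_left,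
      pair_add_right, h p _ (J.mapsTo p a ha) _ (K.mapsTo p d hd), h p a ha d hd,
      h.symm p _ (K.mapsTo p b hb) _ (J.mapsTo p c hc), h.symm p b hb c hc]
    linarith
  smooth U x hx := (J.smooth U x hx).add (K.smooth U x hx)

/-- The fibre at `p` of the `i`-eigenbundle `L_J = {x - i J x | x ∈ A}`. -/
def SGF.eigenFiber {A : SplitStructure F M} (J : SGF A) (p : M) : Set (CGT F p) :=
  {z | ∃ x ∈ A.fiber p, z = mkC x (-J.toFun p x)}

/-- The smooth complex sections `Γ(L_J)` of the `i`-eigenbundle of `J`. -/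
def SGF.eigenSections {A : SplitStructure F M} (J : SGF A) : Set ((p : M) → CGT F p) :=
  {z | z ∈ sectionsC (fun _ => ⊤) ∧ ∀ p, z p ∈ J.eigenFiber p}

/-- `J` is a split generalized CRF-structure: `L_J` is closed under the Dorfman bracket.
(The bracket of smooth sections is smooth, so only its values have to be tested.) -/
def SGF.IsCRF {A : SplitStructure F M} (J : SGF A) : Prop :=
  ∀ z ∈ J.eigenSections, ∀ w ∈ J.eigenSections, ∀ p, dorfmanC z w p ∈ J.eigenFiber p

/-- The normalizer `𝕀_U(A)`: sections `x` over `U` with `[x, Γ_U(A)] ⊆ Γ_U(A)`. -/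
def SplitStructure.normalizer (A : SplitStructure F M) (U : Opens M) :
    Set ((p : M) → GT F p) :=
  {x | x ∈ sections U (fun _ => ⊤) ∧ ∀ s ∈ sections U A.fiber, ∀ p ∈ U, dorfman x s p ∈ A.fiber p}

/-- The real elements of the normalizer `𝕀(J) = 𝕀(L_J)`: real global sections `x` with
`[x, Γ(L_J)] ⊆ Γ(L_J)`. -/
def SGF.normalizer {A : SplitStructure F M} (J : SGF A) : Set ((p : M) → GT F p) :=
  {x | x ∈ sections ⊤ (fun _ => ⊤) ∧
    ∀ z ∈ J.eigenSections, ∀ p, dorfmanC (fun q => mkC (x q) 0) z p ∈ J.eigenFiber p}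

/-- A framing over `U` of `A`: a real subspace of `Γ_U(A)`, of dimension the rank of `A`, whose
`C^∞(U)`-span is `Γ_U(A)`. -/
structure IsFraming (U : Opens M) (A : SplitStructure F M)
    (V : Submodule ℝ ((p : M) → GT F p)) : Prop where
  finrank_eq : Module.finrank ℝ V = 2 * A.halfRank
  span_eq : Submodule.span (smoothRing F ℝ U) (V : Set ((p : M) → GT F p)) = sections U A.fiber

/-- `(J, V)` is a normal pair, where `J` is a split generalized CRF-structure on `A` and `V` is a
global framing of `B ⊆ A^⊥`. -/
structure IsNormalPair {A : SplitStructure F M} (J : SGF A) (B : SplitStructure F M)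
    (V : Submodule ℝ ((p : M) → GT F p)) : Prop where
  orth : B.Orthogonal A
  isCRF : J.IsCRF
  framing : IsFraming ⊤ B V
  normalizes : (V : Set ((p : M) → GT F p)) ⊆ J.normalizer ∩ B.normalizer ⊤

/-! ## Morimoto data -/

/-- The complexification `V ⊗ ℂ` of a real space `V` of sections, inside complex sections. -/
def complexSpan (V : Submodule ℝ ((p : M) → GT F p)) : Set ((p : M) → CGT F p) :=
  {z | ∃ x ∈ V, ∃ y ∈ V, z = fun p => mkC (x p) (y p)}

/-- `(V₁, V₂, Ψ)` is an admissible triple: for some isomorphism `φ : Γ(A ⊗ ℂ) → Γ(B ⊗ ℂ)` of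
`C^∞(M, ℂ)`-modules, `φ(V₁ ⊗ ℂ) = V₂ ⊗ ℂ` and `L_Ψ` is the graph `{e + φ(e)}` of `φ`. -/
def IsAdmissible {A B : SplitStructure F M} (h : A.Orthogonal B)
    (V₁ V₂ : Submodule ℝ ((p : M) → GT F p)) (Ψ : SGF (A.orthSum B h)) : Prop :=
  ∃ φ : sectionsC A.fiber ≃ₗ[smoothRing F ℂ (⊤ : Opens M)] sectionsC B.fiber,
    {w | ∃ e : sectionsC A.fiber, (e : (p : M) → CGT F p) ∈ complexSpan V₁ ∧
      w = (φ e : (p : M) → CGT F p)} = complexSpan V₂ ∧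
    Ψ.eigenSections = {z | ∃ e : sectionsC A.fiber,
      z = (e : (p : M) → CGT F p) + (φ e : (p : M) → CGT F p)}

variable (F M) in
/-- A Morimoto datum on `M`, with its underlying mutually orthogonal split structures. -/
structure MorimotoDatum where
  E₁ : SplitStructure F M
  E₂ : SplitStructure F M
  E₁' : SplitStructure F M
  E₂' : SplitStructure F M
  orth₁₂ : E₁.Orthogonal E₂
  orth₁₁' : E₁.Orthogonal E₁'
  orth₁₂' : E₁.Orthogonal E₂'
  orth₂₁' : E₂.Orthogonal E₁'
  orth₂₂' : E₂.Orthogonal E₂'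
  orth₁'₂' : E₁'.Orthogonal E₂'
  J₁ : SGF E₁
  J₂ : SGF E₂
  V₁ : Submodule ℝ ((p : M) → GT F p)
  V₂ : Submodule ℝ ((p : M) → GT F p)
  Ψ : SGF (E₁'.orthSum E₂' orth₁'₂')
  framing₁ : IsFraming ⊤ E₁' V₁
  framing₂ : IsFraming ⊤ E₂' V₂
  normalizes₁ : (V₁ : Set ((p : M) → GT F p)) ⊆
    (E₁.orthSum E₁' orth₁₁').normalizer ⊤ ∩ (E₂.orthSum E₂' orth₂₂').normalizer ⊤
  normalizes₂ : (V₂ : Set ((p : M) → GT F p)) ⊆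
    (E₁.orthSum E₁' orth₁₁').normalizer ⊤ ∩ (E₂.orthSum E₂' orth₂₂').normalizer ⊤
  localFraming₁ : ∀ p : M, ∃ U : Opens M, p ∈ U ∧ ∃ W : Submodule ℝ ((p : M) → GT F p),
    IsFraming U E₁ W ∧ (W : Set ((p : M) → GT F p)) ⊆
      (E₁.orthSum E₁' orth₁₁').normalizer U ∩ (E₂.orthSum E₂' orth₂₂').normalizer U
  localFraming₂ : ∀ p : M, ∃ U : Opens M, p ∈ U ∧ ∃ W : Submodule ℝ ((p : M) → GT F p),
    IsFraming U E₂ W ∧ (W : Set ((p : M) → GT F p)) ⊆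
      (E₁.orthSum E₁' orth₁₁').normalizer U ∩ (E₂.orthSum E₂' orth₂₂').normalizer U
  admissible : IsAdmissible orth₁'₂' V₁ V₂ Ψ

namespace MorimotoDatum

variable (D : MorimotoDatum F M)

/-- `E₁'' = E₁ ⊕ E₁'`. -/
def E₁'' : SplitStructure F M := D.E₁.orthSum D.E₁' D.orth₁₁'

/-- `E₂'' = E₂ ⊕ E₂'`. -/
def E₂'' : SplitStructure F M := D.E₂.orthSum D.E₂' D.orth₂₂'

/-- The local framings `W` of `A` near every point that are required to exist in a Morimoto datum
can be chosen with `d⟨J(W), W⟩ ⊆ Γ(B)`. -/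
def HasAdaptedFramings {A : SplitStructure F M} (J : SGF A) (B : SplitStructure F M) : Prop :=
  ∀ p : M, ∃ U : Opens M, p ∈ U ∧ ∃ W : Submodule ℝ ((p : M) → GT F p),
    IsFraming U A W ∧
    (W : Set ((p : M) → GT F p)) ⊆ D.E₁''.normalizer U ∩ D.E₂''.normalizer U ∧
    ∀ w ∈ W, ∀ z ∈ W, ∀ q ∈ U, dSection (fun r => pair (J.toFun r (w r)) (z r)) q ∈ B.fiber q

/-- `D` is adaptable: both `E₁` and `E₂` have adapted local framings. -/
def IsAdaptable : Prop :=
  D.HasAdaptedFramings D.J₁ D.E₁'' ∧ D.HasAdaptedFramings D.J₂ D.E₂''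

lemma orth_sum : (D.E₁.orthSum D.E₂ D.orth₁₂).Orthogonal (D.E₁'.orthSum D.E₂' D.orth₁'₂') := by
  intro p x hx y hy
  obtain ⟨a, ha, b, hb, rfl⟩ := Submodule.mem_sup.1 hx
  obtain ⟨c, hc, d, hd, rfl⟩ := Submodule.mem_sup.1 hy
  simp only [pair_add_left, pair_add_right, D.orth₁₁' p a ha c hc, D.orth₁₂' p a ha d hd,
    D.orth₂₁' p b hb c hc, D.orth₂₂' p b hb d hd, add_zero]

/-- `E'' = E₁'' ⊕ E₂''`, written as `(E₁ ⊕ E₂) ⊕ (E₁' ⊕ E₂')`. -/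
def E'' : SplitStructure F M :=
  (D.E₁.orthSum D.E₂ D.orth₁₂).orthSum (D.E₁'.orthSum D.E₂' D.orth₁'₂') D.orth_sum

lemma E''_fiber (p : M) : D.E''.fiber p = D.E₁''.fiber p ⊔ D.E₂''.fiber p :=
  sup_sup_sup_comm _ _ _ _

/-- `J = J₁ ⊕ J₂ ⊕ Ψ` on `E''`. -/
def J : SGF D.E'' := (D.J₁.orthSum D.J₂ D.orth₁₂).orthSum D.Ψ D.orth_sum

end MorimotoDatum

end SGF

end GenGeom

end

/-!
The proof rests on a few properties of the Dorfman bracket: it is local, additive, a derivation in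
its second argument (`dorfman_smul_right`), and its symmetric part is a differential,
`[x, y] + [y, x] = 2 d⟨x, y⟩` (`dorfman_add_dorfman_swap`). In particular brackets of orthogonal
sections are skew, and so are brackets of sections of the isotropic bundles `L_J`. Neither the
Jacobi identity nor the invariance of the inner product is needed.

A section normalizing both `E₁''` and `E₂''` and lying in one of them commutes with every such
section lying in the other: the two brackets lie in different summands and are opposite to each
other (`Normalizes.dorfman_eq_zero`). Hence `V₁` commutes with `V₂`, and the local framings of
`E₁` commute with `V₂` and with the local framings of `E₂`.

Adaptability of the framings of `E₁` has two consequences. A normalizing section `y` of `E₂''`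
preserves `L_{J₁}`: for `z = ∑ fᵢ wᵢ` in a framing, `[y, z] = ∑ y(fᵢ) wᵢ`, and `y` annihilates the
functions `⟨wᵢ, wⱼ⟩` and `⟨J₁ wᵢ, wⱼ⟩`, so that differentiating the equation of `L_{J₁}` along `y`
shows that `∑ y(fᵢ) wᵢ` satisfies it too (`IsFraming.sum_derivC_mem_eigen`,
`dorfmanC_mem_eigen_J₁`). Moreover the brackets of sections of `L_{J₁}` lie in `E₁'' ⊗ ℂ`
(`dorfmanC_mem_cFiber`). Conversely, if `J₁` is a generalized CRF-structure, then every
normalizing framing of `E₁` is adapted (`hasAdaptedFramings_of_isCRF`).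

If `J` is a generalized CRF-structure, the assertions on the summands follow from
`L_J ∩ E₁'' ⊗ ℂ = L_{J₁}` (`mem_eigen_J₁`, which needs the admissibility of `Ψ`) and
`L_J ∩ (E₁' ⊕ E₂') ⊗ ℂ = L_Ψ` (`mem_eigen_Ψ`), once the brackets are known to lie in `E₁'' ⊗ ℂ`
or in `(E₁' ⊕ E₂') ⊗ ℂ`. For the latter one needs `[V₁, V₁] ⊆ Γ(E₁')` (`dorfman_mem_E₁'`): in
`[v + φ(v), v' + φ(v')] = [v, v'] + [φ(v), φ(v')]` the component in `E₁` is real, and `L_{J₁}`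
contains no nonzero real vector.

In the other direction, a section of `L_J` is a sum of sections of `L_{J₁}`, `L_{J₂}` and `L_Ψ`
(`exists_decomposition`), and sections of `L_Ψ` are combinations of the `v + φ(v)` with `v ∈ V₁`;
the mixed brackets are treated by the above consequences of adaptability. Statements about the
second factor are obtained from those about the first by `MorimotoDatum.swap`.

Brackets are computed at a point `p`, for germs at `p` of smooth sections (`SmoothNear`); bump
functions turn germs into sections over the open sets occurring in the definitions
(`SmoothNear.exists_mem_sections`).
-/

noncomputable section

namespace GenGeom

open Filter Topology

set_option linter.unusedSectionVars false

/-! ### The Dorfman bracket at a point -/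

section Pointwise

variable {F : Type*} [NormedAddCommGroup F] [NormedSpace ℝ F]
  {M : Type*} [TopologicalSpace M] [ChartedSpace F M] [IsManifold 𝓘(ℝ, F) ∞ M]

/-- Smoothness near `p` of a section of `TM ⊕ T^*M`. -/
def SmoothNear (p : M) (x : (q : M) → GT F q) : Prop :=
  ∃ U : Opens M, p ∈ U ∧ IsSmoothOn U x

variable (F) in
/-- Smoothness near `p` of a function with values in `𝕜`. -/
def FunNear {𝕜 : Type*} [RCLike 𝕜] (p : M) (f : M → 𝕜) : Prop :=
  ∃ U : Opens M, p ∈ U ∧ ContMDiffOn 𝓘(ℝ, F) 𝓘(ℝ, 𝕜) ∞ f U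

/-- Differentiability at `p` of a vector field. -/
def VecDiffAt (p : M) (X : (q : M) → TangentSpace 𝓘(ℝ, F) q) : Prop :=
  MDifferentiableAt 𝓘(ℝ, F) (𝓘(ℝ, F).prod 𝓘(ℝ, F)) (fun q => (⟨q, X q⟩ : TangentBundle 𝓘(ℝ, F) M)) p

/-- Differentiability at `p` of a one-form. -/
def FormDiffAt (p : M) (α : (q : M) → TangentSpace 𝓘(ℝ, F) q →L[ℝ] ℝ) : Prop :=
  MDifferentiableAt 𝓘(ℝ, F) (𝓘(ℝ, F).prod 𝓘(ℝ, F →L[ℝ] ℝ))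
    (fun p => Bundle.TotalSpace.mk' (F →L[ℝ] ℝ)
      (E := fun q : M => TangentSpace 𝓘(ℝ, F) q →L[ℝ] Bundle.Trivial M ℝ q) p (α p)) p

/-- The representative of the one-form `α` in the preferred chart at `p`. -/
def localForm (α : (q : M) → TangentSpace 𝓘(ℝ, F) q →L[ℝ] ℝ) (p : M) (u : F) : F →L[ℝ] ℝ :=
  (α ((extChartAt 𝓘(ℝ, F) p).symm u)).comp
    (mfderiv 𝓘(ℝ, F) 𝓘(ℝ, F) (extChartAt 𝓘(ℝ, F) p).symm u)

/-- A differentiable form has differentiable local representatives, since in the Hom bundle `T^*M` the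
coordinates at `p` of a form are those of its pullback under the inverse chart. -/
lemma differentiableAt_localForm {α : (q : M) → TangentSpace 𝓘(ℝ, F) q →L[ℝ] ℝ} {p : M}
    (h : FormDiffAt p α) :
    DifferentiableAt ℝ (localForm α p) (extChartAt 𝓘(ℝ, F) p p) := by
  rw [FormDiffAt, mdifferentiableAt_hom_bundle] at h
  have h2 := h.2
  have hs : MDifferentiableAt 𝓘(ℝ, F) 𝓘(ℝ, F) (extChartAt 𝓘(ℝ, F) p).symm
      (extChartAt 𝓘(ℝ, F) p p) := by
    have := mdifferentiableWithinAt_extChartAt_symm (I := 𝓘(ℝ, F))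
      (mem_extChartAt_target (I := 𝓘(ℝ, F)) p)
    rwa [ModelWithCorners.range_eq_univ, mdifferentiableWithinAt_univ] at this
  have hp : (extChartAt 𝓘(ℝ, F) p).symm (extChartAt 𝓘(ℝ, F) p p) = p := extChartAt_to_inv p
  have h3 := MDifferentiableAt.comp (extChartAt 𝓘(ℝ, F) p p) (hp.symm ▸ h2) hs
  rw [mdifferentiableAt_iff_differentiableAt] at h3
  refine h3.congr_of_eventuallyEq ?_
  filter_upwards [extChartAt_target_mem_nhds (I := 𝓘(ℝ, F)) p] with u hu
  have hu' : (extChartAt 𝓘(ℝ, F) p).symm u ∈ (chartAt F p).source := by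
    simpa using (extChartAt 𝓘(ℝ, F) p).map_target hu
  have e := TangentBundle.symmL_trivializationAt (I := 𝓘(ℝ, F)) hu'
  rw [(extChartAt 𝓘(ℝ, F) p).right_inv hu] at e
  simp only [modelWithCornersSelf_coe, Set.range_id, mfderivWithin_univ] at e
  ext v
  simp only [Function.comp, ContinuousLinearMap.inCoordinates, localForm,
    ContinuousLinearMap.comp_apply]
  rw [hp, e]
  exact (Bundle.Trivial.continuousLinearMapAt_trivialization ℝ M ℝ _ ▸ rfl)

/-- The differential at `p` of the preferred chart at `p`, with values in the model space. -/
def chartDiff (p : M) : TangentSpace 𝓘(ℝ, F) p →L[ℝ] F :=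
  mfderiv 𝓘(ℝ, F) 𝓘(ℝ, F) (extChartAt 𝓘(ℝ, F) p) p

/-- In the preferred chart at `p`, `(ι_v dα)(w) = (D_v α)(w) - (D_w α)(v)`. -/
lemma contractExtDeriv_eq (α : (q : M) → TangentSpace 𝓘(ℝ, F) q →L[ℝ] ℝ) (p : M)
    (v w : TangentSpace 𝓘(ℝ, F) p) :
    contractExtDeriv α p v w =
      fderiv ℝ (localForm α p) (extChartAt 𝓘(ℝ, F) p p) (chartDiff p v) (chartDiff p w) -
      fderiv ℝ (localForm α p) (extChartAt 𝓘(ℝ, F) p p) (chartDiff p w) (chartDiff p v) := rfl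

lemma contractExtDeriv_vec_add (α : (q : M) → TangentSpace 𝓘(ℝ, F) q →L[ℝ] ℝ) (p : M)
    (v w : TangentSpace 𝓘(ℝ, F) p) :
    contractExtDeriv α p (v + w) = contractExtDeriv α p v + contractExtDeriv α p w := by
  ext u
  simp only [contractExtDeriv_eq, add_apply, map_add]
  ring

lemma contractExtDeriv_vec_smul (α : (q : M) → TangentSpace 𝓘(ℝ, F) q →L[ℝ] ℝ) (p : M)
    (c : ℝ) (v : TangentSpace 𝓘(ℝ, F) p) :
    contractExtDeriv α p (c • v) = c • contractExtDeriv α p v := by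
  ext u
  simp only [contractExtDeriv_eq, smul_apply, map_smul, smul_eq_mul]
  ring

lemma localForm_self (α : (q : M) → TangentSpace 𝓘(ℝ, F) q →L[ℝ] ℝ) (p : M)
    (v : TangentSpace 𝓘(ℝ, F) p) :
    localForm α p (extChartAt 𝓘(ℝ, F) p p) (chartDiff p v) = α p v := by
  have h := mfderivWithin_extChartAt_symm_comp_mfderiv_extChartAt' (I := 𝓘(ℝ, F))
    (mem_extChartAt_source (I := 𝓘(ℝ, F)) p)
  rw [ModelWithCorners.range_eq_univ, mfderivWithin_univ] at h
  have h2 := DFunLike.congr_fun h v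
  have h3 : ∀ (q : M), q = p → ∀ w : F, α q w = α p w := by
    rintro _ rfl w; rfl
  exact (h3 _ (extChartAt_to_inv p) _).trans (congrArg (α p) h2)

lemma differentiableAt_comp_chart_symm {f : M → ℝ} {p : M}
    (hf : MDifferentiableAt 𝓘(ℝ, F) 𝓘(ℝ, ℝ) f p) :
    DifferentiableAt ℝ (f ∘ (extChartAt 𝓘(ℝ, F) p).symm) (extChartAt 𝓘(ℝ, F) p p) := by
  have := hf.differentiableWithinAt_writtenInExtChartAt
  rw [ModelWithCorners.range_eq_univ, differentiableWithinAt_univ] at this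
  exact this

lemma fderiv_comp_chart_symm {f : M → ℝ} {p : M}
    (hf : MDifferentiableAt 𝓘(ℝ, F) 𝓘(ℝ, ℝ) f p) (v : TangentSpace 𝓘(ℝ, F) p) :
    fderiv ℝ (f ∘ (extChartAt 𝓘(ℝ, F) p).symm) (extChartAt 𝓘(ℝ, F) p p) (chartDiff p v) =
      mvfderiv 𝓘(ℝ, F) f p v := by
  -- the tangent space at `p` is by definition the model space, via the preferred chart at `p`
  have h1 : chartDiff p v = v := by
    unfold chartDiff
    rw [mfderiv_extChartAt_self (I := 𝓘(ℝ, F)) (x := p)]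
    rfl
  have h2 := hf.mfderiv
  rw [ModelWithCorners.range_eq_univ, fderivWithin_univ] at h2
  simp only [writtenInExtChartAt, extChartAt_model_space_eq_id, PartialEquiv.refl_coe,
    Function.id_comp] at h2
  rw [h1, mvfderiv, ContinuousLinearMap.comp_apply, h2]
  rfl

/-- `ι_v d(f β) = f ι_v dβ + df(v) β - β(v) df`. -/
lemma contractExtDeriv_smul {f : M → ℝ} {β : (q : M) → TangentSpace 𝓘(ℝ, F) q →L[ℝ] ℝ} {p : M}
    (hf : MDifferentiableAt 𝓘(ℝ, F) 𝓘(ℝ, ℝ) f p) (hβ : FormDiffAt p β)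
    (v : TangentSpace 𝓘(ℝ, F) p) :
    contractExtDeriv (fun q => f q • β q) p v =
      f p • contractExtDeriv β p v + mvfderiv 𝓘(ℝ, F) f p v • β p
        - β p v • mvfderiv 𝓘(ℝ, F) f p := by
  have e : localForm (fun q => f q • β q) p =
    fun u => (f ∘ (extChartAt 𝓘(ℝ, F) p).symm) u • localForm β p u := rfl
  ext w
  simp only [contractExtDeriv_eq, e, add_apply, smul_apply,
    sub_apply, ← fderiv_comp_chart_symm hf, ← localForm_self β]
  rw [fderiv_fun_smul (differentiableAt_comp_chart_symm hf) (differentiableAt_localForm hβ)]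
  simp only [add_apply, smul_apply, ContinuousLinearMap.smulRight_apply, smul_eq_mul, Function.comp,
    extChartAt_to_inv]
  ring

lemma contractExtDeriv_add {α β : (q : M) → TangentSpace 𝓘(ℝ, F) q →L[ℝ] ℝ} {p : M}
    (hα : FormDiffAt p α) (hβ : FormDiffAt p β) (v : TangentSpace 𝓘(ℝ, F) p) :
    contractExtDeriv (fun q => α q + β q) p v =
      contractExtDeriv α p v + contractExtDeriv β p v := by
  have e : localForm (fun q => α q + β q) p = fun u => localForm α p u + localForm β p u := by
    ext u v; rfl
  ext w
  simp only [contractExtDeriv_eq, e, add_apply]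
  rw [fderiv_fun_add (differentiableAt_localForm hα) (differentiableAt_localForm hβ)]
  simp only [add_apply]
  ring

lemma contractExtDeriv_congr {α β : (q : M) → TangentSpace 𝓘(ℝ, F) q →L[ℝ] ℝ} {p : M}
    (h : ∀ᶠ q in 𝓝 p, α q = β q) (v : TangentSpace 𝓘(ℝ, F) p) :
    contractExtDeriv α p v = contractExtDeriv β p v := by
  have h2 : ∀ᶠ u in 𝓝 (extChartAt 𝓘(ℝ, F) p p), localForm α p u = localForm β p u := by
    have hp : (extChartAt 𝓘(ℝ, F) p).symm (extChartAt 𝓘(ℝ, F) p p) = p := extChartAt_to_inv p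
    have := (continuousAt_extChartAt_symm (I := 𝓘(ℝ, F)) p).tendsto
    rw [hp] at this
    filter_upwards [this.eventually h] with u hu
    simp only [localForm, hu]
  ext w
  simp only [contractExtDeriv_eq]
  rw [Filter.EventuallyEq.fderiv_eq h2]

lemma SmoothNear.vecDiffAt {p : M} {x : (q : M) → GT F q} (h : SmoothNear p x) :
    VecDiffAt p (fun q => (x q).1) := by
  obtain ⟨U, hp, hx⟩ := h
  exact (hx.1.contMDiffAt (U.2.mem_nhds hp)).mdifferentiableAt (by simp)

lemma SmoothNear.formDiffAt {p : M} {x : (q : M) → GT F q} (h : SmoothNear p x) :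
    FormDiffAt p (fun q => (x q).2) := by
  obtain ⟨U, hp, hx⟩ := h
  exact (hx.2.contMDiffAt (U.2.mem_nhds hp)).mdifferentiableAt (by simp)

lemma FunNear.mdifferentiableAt {𝕜 : Type*} [RCLike 𝕜] {p : M} {f : M → 𝕜} (h : FunNear F p f) :
    MDifferentiableAt 𝓘(ℝ, F) 𝓘(ℝ, 𝕜) f p := by
  obtain ⟨U, hp, hx⟩ := h
  exact (hx.contMDiffAt (U.2.mem_nhds hp)).mdifferentiableAt (by simp)

lemma SmoothNear.contract {p : M} {x y : (q : M) → GT F q} (hx : SmoothNear p x)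
    (hy : SmoothNear p y) : MDifferentiableAt 𝓘(ℝ, F) 𝓘(ℝ, ℝ) (fun q => (x q).2 (y q).1) p := by
  have h := MDifferentiableAt.clm_bundle_apply (F₁ := F) (F₂ := ℝ)
    (E₁ := fun q : M => TangentSpace 𝓘(ℝ, F) q) (E₂ := Bundle.Trivial M ℝ)
    (b := id) hx.formDiffAt hy.vecDiffAt
  rw [mdifferentiableAt_totalSpace] at h
  exact h.2

lemma SmoothNear.mdifferentiableAt_pair {p : M} {x y : (q : M) → GT F q} (hx : SmoothNear p x)
    (hy : SmoothNear p y) : MDifferentiableAt 𝓘(ℝ, F) 𝓘(ℝ, ℝ) (fun q => pair (x q) (y q)) p := by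
  have h := ((hx.contract hy).add (hy.contract hx)).const_smul (2⁻¹ : ℝ)
  refine h.congr_of_eventuallyEq (Eventually.of_forall fun q => ?_)
  simp only [pair, Pi.smul_apply, Pi.add_apply, smul_eq_mul]
  ring

lemma dorfman_congr {p : M} {x x' y y' : (q : M) → GT F q}
    (hx : ∀ᶠ q in 𝓝 p, x q = x' q) (hy : ∀ᶠ q in 𝓝 p, y q = y' q) :
    dorfman x y p = dorfman x' y' p := by
  have hx1 : (fun q => (x q).1) =ᶠ[𝓝 p] fun q => (x' q).1 := hx.mono fun q h => congrArg Prod.fst h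
  have hx2 : ∀ᶠ q in 𝓝 p, (x q).2 = (x' q).2 := hx.mono fun q h => congrArg Prod.snd h
  have hy1 : (fun q => (y q).1) =ᶠ[𝓝 p] fun q => (y' q).1 := hy.mono fun q h => congrArg Prod.fst h
  have hy2 : ∀ᶠ q in 𝓝 p, (y q).2 = (y' q).2 := hy.mono fun q h => congrArg Prod.snd h
  have h3 : (fun q => (y q).2 (x q).1) =ᶠ[𝓝 p] fun q => (y' q).2 (x' q).1 := by
    filter_upwards [hx, hy] with q h1 h2
    rw [h1, h2]
  refine Prod.ext (hx1.mlieBracket_vectorField_eq hy1) ?_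
  simp only [dorfman, lieDerivForm]
  rw [contractExtDeriv_congr hx2, contractExtDeriv_congr hy2,
    hx.self_of_nhds, hy.self_of_nhds, mvfderiv, mvfderiv, h3.mfderiv_eq]
  rfl

variable [FiniteDimensional ℝ F]

/-- The Dorfman bracket satisfies the Leibniz rule in its second argument. -/
lemma dorfman_smul_right {p : M} {f : M → ℝ} {x y : (q : M) → GT F q} (hf : FunNear F p f)
    (hx : SmoothNear p x) (hy : SmoothNear p y) :
    dorfman x (fun q => f q • y q) p =
      f p • dorfman x y p + mvfderiv 𝓘(ℝ, F) f p (x p).1 • y p := by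
  have : CompleteSpace F := FiniteDimensional.complete ℝ F
  refine Prod.ext ?_ ?_
  · have := VectorField.mlieBracket_smul_right (V := fun q => (x q).1) hf.mdifferentiableAt
      hy.vecDiffAt
    exact this.trans (add_comm _ _)
  · simp only [dorfman, lieDerivForm, Prod.smul_fst, Prod.smul_snd, Prod.snd_add]
    rw [contractExtDeriv_smul hf.mdifferentiableAt hy.formDiffAt]
    have h := mvfderiv_mul hf.mdifferentiableAt (hy.contract hx)
    have h2 : (fun q => (f q • (y q).2) (x q).1) = f * (fun q => (y q).2 (x q).1) := rfl
    rw [h2, h, contractExtDeriv_vec_smul]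
    module

lemma dorfman_add_right {p : M} {x y z : (q : M) → GT F q}
    (hx : SmoothNear p x) (hy : SmoothNear p y) (hz : SmoothNear p z) :
    dorfman x (fun q => y q + z q) p = dorfman x y p + dorfman x z p := by
  have : CompleteSpace F := FiniteDimensional.complete ℝ F
  refine Prod.ext ?_ ?_
  · exact VectorField.mlieBracket_add_right (V := fun q => (x q).1) hy.vecDiffAt hz.vecDiffAt
  · simp only [dorfman, lieDerivForm, Prod.fst_add, Prod.snd_add]
    rw [contractExtDeriv_add hy.formDiffAt hz.formDiffAt]
    have h := mvfderiv_add (hy.contract hx) (hz.contract hx)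
    have h2 : (fun q => ((y q).2 + (z q).2) (x q).1) =
      (fun q => (y q).2 (x q).1) + (fun q => (z q).2 (x q).1) := rfl
    rw [h2, h, contractExtDeriv_vec_add]
    module

lemma dorfman_add_dorfman_swap {p : M} {x y : (q : M) → GT F q}
    (hx : SmoothNear p x) (hy : SmoothNear p y) :
    dorfman x y p + dorfman y x p = (2 : ℝ) • dSection (fun q => pair (x q) (y q)) p := by
  refine Prod.ext ?_ ?_
  · simp only [dorfman, dSection, Prod.fst_add, Prod.smul_fst, smul_zero]
    rw [VectorField.mlieBracket_swap_apply, neg_add_cancel]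
  · simp only [dorfman, dSection, lieDerivForm, Prod.snd_add, Prod.smul_snd]
    have h := mvfderiv_add (hx.contract hy) (hy.contract hx)
    have h2 : (fun q => (x q).2 (y q).1) + (fun q => (y q).2 (x q).1) =
      fun q => (2 : ℝ) • pair (x q) (y q) := by
      ext q; simp only [pair, Pi.add_apply, smul_eq_mul]; ring
    have h3 : mvfderiv 𝓘(ℝ, F) (fun q => (2 : ℝ) • pair (x q) (y q)) p =
      (2 : ℝ) • mvfderiv 𝓘(ℝ, F) (fun q => pair (x q) (y q)) p := by
      have := mvfderiv_smul (mdifferentiableAt_const (c := (2 : ℝ))) (hx.mdifferentiableAt_pair hy)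
      rw [mvfderiv_const] at this
      refine this.trans ?_
      ext v
      simp
    rw [← h3, ← h2, h]
    abel

lemma dorfman_add_left {p : M} {x y z : (q : M) → GT F q}
    (hx : SmoothNear p x) (hy : SmoothNear p y) (hz : SmoothNear p z) :
    dorfman (fun q => x q + y q) z p = dorfman x z p + dorfman y z p := by
  have : CompleteSpace F := FiniteDimensional.complete ℝ F
  refine Prod.ext ?_ ?_
  · exact VectorField.mlieBracket_add_left (W := fun q => (z q).1) hx.vecDiffAt hy.vecDiffAt
  · simp only [dorfman, lieDerivForm, Prod.fst_add, Prod.snd_add]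
    rw [contractExtDeriv_add hx.formDiffAt hy.formDiffAt]
    have h := mvfderiv_add (hz.contract hx) (hz.contract hy)
    have h2 : (fun q => (z q).2 ((x q).1 + (y q).1)) =
      (fun q => (z q).2 (x q).1) + (fun q => (z q).2 (y q).1) := by ext q; simp
    rw [h2, h, contractExtDeriv_vec_add]
    abel

end Pointwise

/-! ### Germs of smooth sections -/

section Germs

variable {F : Type*} [NormedAddCommGroup F] [NormedSpace ℝ F]
  {M : Type*} [TopologicalSpace M] [ChartedSpace F M] [IsManifold 𝓘(ℝ, F) ∞ M]

namespace FunNear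

variable {𝕜 : Type*} [RCLike 𝕜] {p : M} {f g : M → 𝕜}

lemma const (c : 𝕜) : FunNear F p (fun _ => c) := ⟨⊤, trivial, contMDiffOn_const⟩

lemma re {f : M → ℂ} (hf : FunNear F p f) : FunNear F p (fun q => (f q).re) := by
  obtain ⟨U, hU, hf⟩ := hf
  exact ⟨U, hU, Complex.reCLM.contDiff.contMDiff.comp_contMDiffOn hf⟩

lemma im {f : M → ℂ} (hf : FunNear F p f) : FunNear F p (fun q => (f q).im) := by
  obtain ⟨U, hU, hf⟩ := hf
  exact ⟨U, hU, Complex.imCLM.contDiff.contMDiff.comp_contMDiffOn hf⟩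

end FunNear

lemma FunNear.smul {p : M} {f : M → ℝ} (hf : FunNear F p f) {x : (q : M) → GT F q}
    (hx : SmoothNear p x) :
    SmoothNear p (fun q => f q • x q) := by
  obtain ⟨U, hU, hf⟩ := hf
  obtain ⟨V, hV, hx⟩ := hx
  exact ⟨U ⊓ V, ⟨hU, hV⟩, IsSmoothOn.smul (hf.mono inf_le_left) (hx.mono inf_le_right)⟩

namespace SmoothNear

variable {p : M} {x y : (q : M) → GT F q}

lemma add (hx : SmoothNear p x) (hy : SmoothNear p y) : SmoothNear p (fun q => x q + y q) := by
  obtain ⟨U, hU, hx⟩ := hx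
  obtain ⟨V, hV, hy⟩ := hy
  exact ⟨U ⊓ V, ⟨hU, hV⟩, (hx.mono inf_le_left).add (hy.mono inf_le_right)⟩

lemma sub (hx : SmoothNear p x) (hy : SmoothNear p y) : SmoothNear p (fun q => x q - y q) := by
  obtain ⟨U, hU, hx⟩ := hx
  obtain ⟨V, hV, hy⟩ := hy
  exact ⟨U ⊓ V, ⟨hU, hV⟩, (hx.mono inf_le_left).sub (hy.mono inf_le_right)⟩

lemma zero : SmoothNear p (fun q => (0 : GT F q)) := ⟨⊤, trivial, IsSmoothOn.zero⟩

lemma neg (hx : SmoothNear p x) : SmoothNear p (fun q => -x q) := by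
  simpa using SmoothNear.zero.sub hx

lemma sum {ι : Type*} (s : Finset ι) {x : ι → (q : M) → GT F q} (h : ∀ i ∈ s, SmoothNear p (x i)) :
    SmoothNear p (fun q => ∑ i ∈ s, x i q) := by
  classical
  induction s using Finset.induction_on with
  | empty => simpa using SmoothNear.zero
  | insert a s ha ih =>
    simp only [Finset.sum_insert ha]
    exact (h a (by simp)).add (ih fun i hi => h i (by simp [hi]))

lemma apply {A : SplitStructure F M} (J : SGF A) (hx : SmoothNear p x) :
    SmoothNear p (fun q => J.toFun q (x q)) := by
  obtain ⟨U, hU, hx⟩ := hx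
  exact ⟨U, hU, J.smooth U x hx⟩

end SmoothNear

end Germs

/-! ### Complexification -/

section Complexification

variable {F : Type*} [NormedAddCommGroup F] [NormedSpace ℝ F]
  {M : Type*} [TopologicalSpace M] [ChartedSpace F M] [IsManifold 𝓘(ℝ, F) ∞ M]

lemma cgt_ext {p : M} {z w : CGT F p} (h : reC z = reC w) (h' : imC z = imC w) : z = w := by
  rw [← mkC_reC_imC z, ← mkC_reC_imC w, h, h']

lemma pair_neg_left {p : M} (x y : GT F p) : pair (-x) y = -pair x y := by
  rw [← neg_one_smul ℝ x, pair_smul_left, neg_one_mul]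

lemma pair_neg_right {p : M} (x y : GT F p) : pair x (-y) = -pair x y := by
  rw [pair_comm, pair_neg_left, pair_comm]

lemma pair_sub_left {p : M} (x y z : GT F p) : pair (x - y) z = pair x z - pair y z := by
  rw [sub_eq_add_neg, pair_add_left, pair_neg_left, sub_eq_add_neg]

lemma pair_sum_left {p : M} {ι : Type*} (s : Finset ι) (x : ι → GT F p) (z : GT F p) :
    pair (∑ i ∈ s, x i) z = ∑ i ∈ s, pair (x i) z := by
  classical
  induction s using Finset.induction_on with
  | empty => simp [pair_zero_left]
  | insert a s ha ih => rw [Finset.sum_insert ha, Finset.sum_insert ha, pair_add_left, ih]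

/-- The complex bilinear extension of the tautological inner product. -/
def pairC {p : M} : CGT F p →ₗ[ℂ] CGT F p →ₗ[ℂ] ℂ :=
  LinearMap.mk₂ ℂ
    (fun z w => ⟨pair (reC z) (reC w) - pair (imC z) (imC w),
      pair (reC z) (imC w) + pair (imC z) (reC w)⟩)
    (fun z z' w => by
      apply Complex.ext <;> simp only [map_add, pair_add_left, Complex.add_re, Complex.add_im] <;>
        ring)
    (fun c z w => by
      apply Complex.ext <;> simp only [reC_smul, imC_smul, sub_eq_add_neg, pair_neg_left,
        pair_add_left, pair_smul_left, smul_eq_mul, Complex.mul_re, Complex.mul_im] <;> ring)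
    (fun z w w' => by
      apply Complex.ext <;> simp only [map_add, pair_add_right, Complex.add_re, Complex.add_im] <;>
        ring)
    (fun c z w => by
      apply Complex.ext <;> simp only [reC_smul, imC_smul, sub_eq_add_neg, pair_neg_left,
        pair_comm (reC z), pair_comm (imC z),
        pair_add_left, pair_smul_left, smul_eq_mul, Complex.mul_re, Complex.mul_im] <;> ring)

lemma pairC_apply {p : M} (z w : CGT F p) :
    pairC z w = ⟨pair (reC z) (reC w) - pair (imC z) (imC w),
      pair (reC z) (imC w) + pair (imC z) (reC w)⟩ := rfl

/-- The complexification of a subspace of a fibre. -/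
def cFiber {p : M} (E : Submodule ℝ (GT F p)) : Submodule ℂ (CGT F p) where
  carrier := {z | reC z ∈ E ∧ imC z ∈ E}
  add_mem' {z w} hz hw := by
    simp only [Set.mem_ofPred_eq, map_add]
    exact ⟨E.add_mem hz.1 hw.1, E.add_mem hz.2 hw.2⟩
  zero_mem' := by simp
  smul_mem' c z hz := by
    simp only [Set.mem_ofPred_eq, reC_smul, imC_smul]
    exact ⟨E.sub_mem (E.smul_mem _ hz.1) (E.smul_mem _ hz.2),
      E.add_mem (E.smul_mem _ hz.2) (E.smul_mem _ hz.1)⟩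

lemma mem_cFiber {p : M} {E : Submodule ℝ (GT F p)} {z : CGT F p} :
    z ∈ cFiber E ↔ reC z ∈ E ∧ imC z ∈ E := Iff.rfl

lemma SGF.apply_apply {A : SplitStructure F M} (J : SGF A) {p : M} {x : GT F p}
    (hx : x ∈ A.fiber p) : J.toFun p (J.toFun p x) = -x := by
  have hJ := J.mapsTo p x hx
  refine eq_neg_of_add_eq_zero_left (A.eq_zero_of_orthogonal
    ((A.fiber p).add_mem (J.mapsTo p _ hJ) hx) fun y hy => ?_)
  rw [pair_add_left, J.skew p _ hJ y hy, J.orthogonal p x hx y hy, neg_add_cancel]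

lemma SGF.mem_eigenFiber {A : SplitStructure F M} (J : SGF A) {p : M} {z : CGT F p} :
    z ∈ J.eigenFiber p ↔ reC z ∈ A.fiber p ∧ imC z = -J.toFun p (reC z) := by
  constructor
  · rintro ⟨x, hx, rfl⟩
    simpa using hx
  · rintro ⟨h, h'⟩
    exact ⟨reC z, h, by rw [← h', mkC_reC_imC]⟩

/-- The fibre of `L_J` as a complex subspace. -/
def SGF.eigen {A : SplitStructure F M} (J : SGF A) (p : M) : Submodule ℂ (CGT F p) where
  carrier := J.eigenFiber p
  add_mem' {z w} hz hw := by
    rw [J.mem_eigenFiber] at *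
    refine ⟨by simpa using (A.fiber p).add_mem hz.1 hw.1, ?_⟩
    simp only [map_add, hz.2, hw.2, neg_add]
  zero_mem' := by
    rw [J.mem_eigenFiber]; simp
  smul_mem' c z hz := by
    rw [J.mem_eigenFiber] at *
    have hz1 : imC z ∈ A.fiber p := by
      rw [hz.2]; exact (A.fiber p).neg_mem (J.mapsTo p _ hz.1)
    refine ⟨by
      rw [reC_smul]
      exact sub_mem ((A.fiber p).smul_mem _ hz.1) ((A.fiber p).smul_mem _ hz1), ?_⟩
    rw [reC_smul, imC_smul, map_sub, map_smul, map_smul, hz.2, map_neg, J.apply_apply hz.1]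
    module

lemma SGF.mem_eigen {A : SplitStructure F M} (J : SGF A) {p : M} {z : CGT F p} :
    z ∈ J.eigen p ↔ reC z ∈ A.fiber p ∧ imC z = -J.toFun p (reC z) := J.mem_eigenFiber

lemma SGF.eigen_le {A : SplitStructure F M} (J : SGF A) (p : M) :
    J.eigen p ≤ cFiber (A.fiber p) := by
  intro z hz
  rw [J.mem_eigen] at hz
  exact ⟨hz.1, hz.2 ▸ (A.fiber p).neg_mem (J.mapsTo p _ hz.1)⟩

/-- `L_J` is isotropic. -/
lemma SGF.pairC_eq_zero {A : SplitStructure F M} (J : SGF A) {p : M} {z w : CGT F p}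
    (hz : z ∈ J.eigen p) (hw : w ∈ J.eigen p) : pairC z w = 0 := by
  rw [J.mem_eigen] at hz hw
  rw [pairC_apply, hz.2, hw.2]
  apply Complex.ext <;> simp only [pair_neg_left, pair_neg_right, Complex.zero_re, Complex.zero_im,
    J.skew p _ hz.1 _ hw.1, J.orthogonal p _ hz.1 _ hw.1] <;> ring

lemma pairC_eq_zero_of_orthogonal {p : M} {E E' : Submodule ℝ (GT F p)}
    (h : ∀ x ∈ E, ∀ y ∈ E', pair x y = 0) {z w : CGT F p} (hz : z ∈ cFiber E)
    (hw : w ∈ cFiber E') : pairC z w = 0 := by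
  rw [pairC_apply, h _ hz.1 _ hw.1, h _ hz.1 _ hw.2, h _ hz.2 _ hw.1, h _ hz.2 _ hw.2]
  apply Complex.ext <;> simp

/-- Smoothness near `p` of a complex section. -/
def SmoothNearC (p : M) (z : (q : M) → CGT F q) : Prop :=
  SmoothNear p (fun q => reC (z q)) ∧ SmoothNear p (fun q => imC (z q))

namespace SmoothNearC

variable {p : M} {z w : (q : M) → CGT F q}

lemma add (hz : SmoothNearC p z) (hw : SmoothNearC p w) : SmoothNearC p (fun q => z q + w q) := by
  simp only [SmoothNearC, map_add]
  exact ⟨hz.1.add hw.1, hz.2.add hw.2⟩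

lemma smul {f : M → ℂ} (hf : FunNear F p f) (hz : SmoothNearC p z) :
    SmoothNearC p (fun q => f q • z q) := by
  simp only [SmoothNearC, reC_smul, imC_smul]
  exact ⟨(hf.re.smul hz.1).sub (hf.im.smul hz.2), (hf.re.smul hz.2).add (hf.im.smul hz.1)⟩

lemma sum {ι : Type*} (s : Finset ι) {x : ι → (q : M) → CGT F q}
    (h : ∀ i ∈ s, SmoothNearC p (x i)) : SmoothNearC p (fun q => ∑ i ∈ s, x i q) := by
  simp only [SmoothNearC, map_sum]
  exact ⟨SmoothNear.sum s fun i hi => (h i hi).1, SmoothNear.sum s fun i hi => (h i hi).2⟩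

lemma mk {x y : (q : M) → GT F q} (hx : SmoothNear p x) (hy : SmoothNear p y) :
    SmoothNearC p (fun q => mkC (x q) (y q)) := by
  simpa only [SmoothNearC, reC_mkC, imC_mkC] using ⟨hx, hy⟩

end SmoothNearC

/-- The derivative of the complex function `f` along the vector part of `ζ ∈ 𝕋_p M ⊗ ℂ`. -/
def derivC {p : M} (ζ : CGT F p) (f : M → ℂ) : ℂ :=
  ⟨mvfderiv 𝓘(ℝ, F) (fun q => (f q).re) p (reC ζ).1 -
      mvfderiv 𝓘(ℝ, F) (fun q => (f q).im) p (imC ζ).1,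
    mvfderiv 𝓘(ℝ, F) (fun q => (f q).im) p (reC ζ).1 +
      mvfderiv 𝓘(ℝ, F) (fun q => (f q).re) p (imC ζ).1⟩

lemma dSection_congr {p : M} {f g : M → ℝ} (h : ∀ᶠ q in 𝓝 p, f q = g q) :
    dSection (F := F) f p = dSection g p := by
  have h' : f =ᶠ[𝓝 p] g := h
  simp only [dSection, mvfderiv, h'.mfderiv_eq]
  rw [h.self_of_nhds]

lemma dSection_neg {p : M} {f : M → ℝ} :
    dSection (F := F) (fun q => -f q) p = -dSection f p :=
  Prod.ext neg_zero.symm mvfderiv_neg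

lemma dorfmanC_congr {p : M} {z z' w w' : (q : M) → CGT F q}
    (hz : ∀ᶠ q in 𝓝 p, z q = z' q) (hw : ∀ᶠ q in 𝓝 p, w q = w' q) :
    dorfmanC z w p = dorfmanC z' w' p := by
  have h1 := hz.mono fun q h => congrArg reC h
  have h2 := hz.mono fun q h => congrArg imC h
  have h3 := hw.mono fun q h => congrArg reC h
  have h4 := hw.mono fun q h => congrArg imC h
  simp only [dorfmanC]
  rw [dorfman_congr h1 h3, dorfman_congr h2 h4, dorfman_congr h1 h4, dorfman_congr h2 h3]

variable [FiniteDimensional ℝ F]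

lemma dorfman_sub_right {p : M} {x y z : (q : M) → GT F q}
    (hx : SmoothNear p x) (hy : SmoothNear p y) (hz : SmoothNear p z) :
    dorfman x (fun q => y q - z q) p = dorfman x y p - dorfman x z p := by
  have := dorfman_add_right hx (hy.sub hz) hz
  simp only [sub_add_cancel] at this
  rw [this, add_sub_cancel_right]

lemma dorfman_zero_right {p : M} {x : (q : M) → GT F q} (hx : SmoothNear p x) :
    dorfman x (fun _ => 0) p = 0 := by
  have := dorfman_sub_right hx SmoothNear.zero SmoothNear.zero
  simpa only [sub_self] using this

lemma dorfman_neg_right {p : M} {x y : (q : M) → GT F q}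
    (hx : SmoothNear p x) (hy : SmoothNear p y) :
    dorfman x (fun q => - y q) p = - dorfman x y p := by
  have := dorfman_sub_right hx SmoothNear.zero hy
  simpa only [zero_sub, dorfman_zero_right hx] using this

lemma dorfman_zero_left {p : M} {x : (q : M) → GT F q} (hx : SmoothNear p x) :
    dorfman (fun _ => 0) x p = 0 := by
  have := dorfman_add_left SmoothNear.zero SmoothNear.zero hx
  simpa only [add_zero, left_eq_add] using this

lemma dorfman_neg_left {p : M} {x y : (q : M) → GT F q}
    (hx : SmoothNear p x) (hy : SmoothNear p y) :
    dorfman (fun q => - x q) y p = - dorfman x y p := by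
  have := dorfman_add_left hx hx.neg hy
  simp only [add_neg_cancel, dorfman_zero_left hy] at this
  exact (neg_eq_of_add_eq_zero_right this.symm).symm

lemma dorfmanC_real_left {p : M} {x : (q : M) → GT F q} {z : (q : M) → CGT F q}
    (hz : SmoothNearC p z) :
    dorfmanC (fun q => mkC (x q) 0) z p =
      mkC (dorfman x (fun q => reC (z q)) p) (dorfman x (fun q => imC (z q)) p) := by
  simp only [dorfmanC, reC_mkC, imC_mkC, dorfman_zero_left hz.1, dorfman_zero_left hz.2, sub_zero,
    add_zero]

lemma dorfmanC_add_right {p : M} {z w w' : (q : M) → CGT F q} (hz : SmoothNearC p z)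
    (hw : SmoothNearC p w) (hw' : SmoothNearC p w') :
    dorfmanC z (fun q => w q + w' q) p = dorfmanC z w p + dorfmanC z w' p := by
  simp only [dorfmanC, map_add]
  rw [dorfman_add_right hz.1 hw.1 hw'.1, dorfman_add_right hz.1 hw.2 hw'.2,
    dorfman_add_right hz.2 hw.1 hw'.1, dorfman_add_right hz.2 hw.2 hw'.2, ← mkC_add]
  congr 1 <;> abel

lemma dorfmanC_add_left {p : M} {z z' w : (q : M) → CGT F q} (hz : SmoothNearC p z)
    (hz' : SmoothNearC p z') (hw : SmoothNearC p w) :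
    dorfmanC (fun q => z q + z' q) w p = dorfmanC z w p + dorfmanC z' w p := by
  simp only [dorfmanC, map_add]
  rw [dorfman_add_left hz.1 hz'.1 hw.1, dorfman_add_left hz.1 hz'.1 hw.2,
    dorfman_add_left hz.2 hz'.2 hw.1, dorfman_add_left hz.2 hz'.2 hw.2, ← mkC_add]
  congr 1 <;> abel

lemma dorfmanC_smul_right {p : M} {f : M → ℂ} {z w : (q : M) → CGT F q} (hf : FunNear F p f)
    (hz : SmoothNearC p z) (hw : SmoothNearC p w) :
    dorfmanC z (fun q => f q • w q) p = f p • dorfmanC z w p + derivC (z p) f • w p := by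
  simp only [dorfmanC, reC_smul, imC_smul]
  rw [dorfman_sub_right hz.1 (hf.re.smul hw.1) (hf.im.smul hw.2),
    dorfman_sub_right hz.2 (hf.re.smul hw.1) (hf.im.smul hw.2),
    dorfman_add_right hz.1 (hf.re.smul hw.2) (hf.im.smul hw.1),
    dorfman_add_right hz.2 (hf.re.smul hw.2) (hf.im.smul hw.1)]
  rw [dorfman_smul_right hf.re hz.1 hw.1, dorfman_smul_right hf.re hz.1 hw.2,
    dorfman_smul_right hf.re hz.2 hw.1, dorfman_smul_right hf.re hz.2 hw.2,
    dorfman_smul_right hf.im hz.1 hw.1, dorfman_smul_right hf.im hz.1 hw.2,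
    dorfman_smul_right hf.im hz.2 hw.1, dorfman_smul_right hf.im hz.2 hw.2]
  apply cgt_ext
  · simp only [map_add, reC_smul, reC_mkC, imC_mkC, derivC]
    module
  · simp only [map_add, imC_smul, reC_mkC, imC_mkC, derivC]
    module

lemma dorfmanC_zero_right {p : M} {z : (q : M) → CGT F q} (hz : SmoothNearC p z) :
    dorfmanC z (fun _ => 0) p = 0 := by
  simp only [dorfmanC, map_zero, dorfman_zero_right hz.1, dorfman_zero_right hz.2]
  simp [mkC]

lemma dorfmanC_sum_smul_right {p : M} {ι : Type*} (s : Finset ι) {f : ι → M → ℂ}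
    {z : (q : M) → CGT F q} {w : ι → (q : M) → CGT F q} (hz : SmoothNearC p z)
    (hf : ∀ i ∈ s, FunNear F p (f i)) (hw : ∀ i ∈ s, SmoothNearC p (w i)) :
    dorfmanC z (fun q => ∑ i ∈ s, f i q • w i q) p =
      ∑ i ∈ s, f i p • dorfmanC z (w i) p + ∑ i ∈ s, derivC (z p) (f i) • w i p := by
  classical
  induction s using Finset.induction_on with
  | empty => simpa using dorfmanC_zero_right hz
  | insert a s ha ih =>
    simp only [Finset.sum_insert ha]
    rw [dorfmanC_add_right hz ((hw a (by simp)).smul (hf a (by simp)))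
      (SmoothNearC.sum s fun i hi => (hw i (by simp [hi])).smul (hf i (by simp [hi]))),
      dorfmanC_smul_right (hf a (by simp)) hz (hw a (by simp)),
      ih (fun i hi => hf i (by simp [hi])) (fun i hi => hw i (by simp [hi]))]
    abel

/-- On orthogonal sections the Dorfman bracket is skew. -/
lemma dorfmanC_swap {p : M} {z w : (q : M) → CGT F q} (hz : SmoothNearC p z)
    (hw : SmoothNearC p w) (h : ∀ᶠ q in 𝓝 p, pairC (z q) (w q) = 0) :
    dorfmanC z w p = - dorfmanC w z p := by
  have h1 : ∀ᶠ q in 𝓝 p, pair (reC (z q)) (reC (w q)) = pair (imC (z q)) (imC (w q)) :=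
    h.mono fun q hq => sub_eq_zero.1 (congrArg Complex.re hq)
  have h2 : ∀ᶠ q in 𝓝 p, pair (reC (z q)) (imC (w q)) = -pair (imC (z q)) (reC (w q)) :=
    h.mono fun q hq => eq_neg_of_add_eq_zero_left (congrArg Complex.im hq)
  have e1 := dorfman_add_dorfman_swap hz.1 hw.1
  have e2 := dorfman_add_dorfman_swap hz.2 hw.2
  have e3 := dorfman_add_dorfman_swap hz.1 hw.2
  have e4 := dorfman_add_dorfman_swap hz.2 hw.1
  rw [dSection_congr h1] at e1
  rw [dSection_congr h2, dSection_neg] at e3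
  rw [eq_neg_iff_add_eq_zero]
  apply cgt_ext
  · simp only [dorfmanC, map_add, reC_mkC, map_zero]
    rw [← sub_eq_zero.2 (e1.trans e2.symm)]
    abel
  · simp only [dorfmanC, map_add, imC_mkC, map_zero]
    rw [smul_neg, ← e4] at e3
    rw [← sub_eq_zero.2 e3]
    abel

end Complexification

/-! ### Localization -/

section Localization

variable {F : Type*} [NormedAddCommGroup F] [NormedSpace ℝ F]
  {M : Type*} [TopologicalSpace M] [ChartedSpace F M] [IsManifold 𝓘(ℝ, F) ∞ M]

lemma smoothNear_of_mem_sections {U : Opens M} {E : (p : M) → Submodule ℝ (GT F p)}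
    {x : (q : M) → GT F q} (hx : x ∈ sections U E) {p : M} (hp : p ∈ U) : SmoothNear p x :=
  ⟨U, hp, hx.1⟩

lemma eventually_mem_of_mem_sections {U : Opens M} {E : (p : M) → Submodule ℝ (GT F p)}
    {x : (q : M) → GT F q} (hx : x ∈ sections U E) {p : M} (hp : p ∈ U) :
    ∀ᶠ q in 𝓝 p, x q ∈ E q := by
  filter_upwards [U.2.mem_nhds hp] with q hq using hx.2.1 q hq

lemma SGF.smoothNearC_of_mem {A : SplitStructure F M} {J : SGF A} {z : (q : M) → CGT F q}
    (hz : z ∈ J.eigenSections) (p : M) : SmoothNearC p z :=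
  ⟨smoothNear_of_mem_sections hz.1.1 trivial, smoothNear_of_mem_sections hz.1.2 trivial⟩

/-- Every vector of a subbundle extends to a smooth section near its base point. -/
lemma SplitStructure.exists_extension (A : SplitStructure F M) {p : M} {ξ : GT F p}
    (hξ : ξ ∈ A.fiber p) :
    ∃ x : (q : M) → GT F q, SmoothNear p x ∧ (∀ᶠ q in 𝓝 p, x q ∈ A.fiber q) ∧ x p = ξ := by
  obtain ⟨U, hU, s, hs, hsU⟩ := A.isSubbundle p
  rw [← (hsU p hU).2] at hξ
  obtain ⟨c, hc⟩ := (Submodule.mem_span_range_iff_exists_fun ℝ).1 hξ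
  refine ⟨fun q => ∑ i, c i • s i q,
    SmoothNear.sum _ fun i _ => FunNear.smul (FunNear.const _) ⟨U, hU, hs i⟩, ?_, hc⟩
  filter_upwards [U.2.mem_nhds hU] with q hq
  rw [← (hsU q hq).2]
  exact sum_mem fun i _ => Submodule.smul_mem _ _ (Submodule.subset_span ⟨i, rfl⟩)

variable [FiniteDimensional ℝ F] [T2Space M]

/-- Multiplication by a bump function turns a germ at `p` of a section of `E` into a section over
`U`. -/
lemma SmoothNear.exists_mem_sections {p : M} {x : (q : M) → GT F q} (hx : SmoothNear p x)
    {E : (p : M) → Submodule ℝ (GT F p)} (hE : ∀ᶠ q in 𝓝 p, x q ∈ E q) {U : Opens M}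
    (hp : p ∈ U) : ∃ y ∈ sections U E, ∀ᶠ q in 𝓝 p, y q = x q := by
  obtain ⟨V, hV, hx⟩ := hx
  obtain ⟨O, hO, hOo, hpO⟩ := eventually_nhds_iff.1 hE
  let O' : Opens M := ⟨O, hOo⟩
  obtain ⟨f, -, hf⟩ := (SmoothBumpFunction.nhds_basis_tsupport (I := 𝓘(ℝ, F)) p).mem_iff.1
    ((U ⊓ (V ⊓ O')).2.mem_nhds ⟨hp, hV, hpO⟩)
  have hsub : tsupport f ⊆ V := fun q hq => (hf hq).2.1
  have h0 : ∀ q, q ∉ U ⊓ (V ⊓ O') → f q = 0 := fun q hq =>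
    image_eq_zero_of_notMem_tsupport fun h => hq (hf h)
  refine ⟨fun q => f q • x q, ⟨⟨?_, ?_⟩, fun q _ => ?_, fun q hq => ?_⟩, ?_⟩
  · exact (ContMDiffOn.smul_section_of_tsupport f.contMDiff.contMDiffOn V.2 hsub hx.1).contMDiffOn
  · exact (ContMDiffOn.smul_section_of_tsupport f.contMDiff.contMDiffOn V.2 hsub hx.2).contMDiffOn
  · by_cases h : q ∈ U ⊓ (V ⊓ O')
    · exact (E q).smul_mem _ (hO q h.2.2)
    · change f q • x q ∈ E q
      rw [h0 q h, zero_smul]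
      exact zero_mem _
  · change f q • x q = 0
    rw [h0 q fun h => hq h.1, zero_smul]
  · filter_upwards [f.eventuallyEq_one] with q hq
    rw [hq, Pi.one_apply, one_smul]

lemma SplitStructure.dorfman_mem_of_mem_normalizer {A : SplitStructure F M} {U : Opens M}
    {x s : (q : M) → GT F q} (hx : x ∈ A.normalizer U) {p : M} (hp : p ∈ U) (hs : SmoothNear p s)
    (hA : ∀ᶠ q in 𝓝 p, s q ∈ A.fiber q) : dorfman x s p ∈ A.fiber p := by
  obtain ⟨y, hy, hys⟩ := hs.exists_mem_sections hA hp
  rw [dorfman_congr (Eventually.of_forall fun _ => rfl) (hys.mono fun q h => h.symm)]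
  exact hx.2 y hy p hp

lemma SmoothNearC.exists_mem_eigenSections {A : SplitStructure F M} {J : SGF A} {p : M}
    {z : (q : M) → CGT F q} (hz : SmoothNearC p z) (hJ : ∀ᶠ q in 𝓝 p, z q ∈ J.eigen q) :
    ∃ w ∈ J.eigenSections, ∀ᶠ q in 𝓝 p, w q = z q := by
  obtain ⟨x, hx, hxz⟩ := hz.1.exists_mem_sections (E := A.fiber) (U := ⊤)
    (hJ.mono fun q h => (J.mem_eigen.1 h).1) trivial
  refine ⟨fun q => mkC (x q) (-J.toFun q (x q)),
    ⟨⟨?_, ?_⟩, fun q => ⟨x q, hx.2.1 q trivial, rfl⟩⟩, ?_⟩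
  · simp only [reC_mkC]
    exact ⟨hx.1, fun _ _ => trivial, fun q hq => (hq trivial).elim⟩
  · simp only [imC_mkC]
    refine ⟨?_, fun _ _ => trivial, fun q hq => (hq trivial).elim⟩
    have := IsSmoothOn.zero.sub (J.smooth ⊤ x hx.1)
    rwa [zero_sub] at this
  · filter_upwards [hxz, hJ] with q h1 h2
    rw [h1, ← (J.mem_eigen.1 h2).2, mkC_reC_imC]

lemma SGF.IsCRF.dorfmanC_mem {A : SplitStructure F M} {J : SGF A} (h : J.IsCRF) {p : M}
    {z w : (q : M) → CGT F q} (hz : SmoothNearC p z) (hw : SmoothNearC p w)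
    (hzJ : ∀ᶠ q in 𝓝 p, z q ∈ J.eigen q) (hwJ : ∀ᶠ q in 𝓝 p, w q ∈ J.eigen q) :
    dorfmanC z w p ∈ J.eigen p := by
  obtain ⟨z', hz', hzz⟩ := hz.exists_mem_eigenSections hzJ
  obtain ⟨w', hw', hww⟩ := hw.exists_mem_eigenSections hwJ
  rw [dorfmanC_congr (hzz.mono fun _ h => h.symm) (hww.mono fun _ h => h.symm)]
  exact h z' hz' w' hw' p

lemma SGF.dorfmanC_mem_of_mem_normalizer {A : SplitStructure F M} {J : SGF A}
    {x : (q : M) → GT F q} (hx : x ∈ J.normalizer) {p : M} {z : (q : M) → CGT F q}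
    (hz : SmoothNearC p z) (hzJ : ∀ᶠ q in 𝓝 p, z q ∈ J.eigen q) :
    dorfmanC (fun q => mkC (x q) 0) z p ∈ J.eigen p := by
  obtain ⟨z', hz', hzz⟩ := hz.exists_mem_eigenSections hzJ
  rw [dorfmanC_congr (Eventually.of_forall fun _ => rfl) (hzz.mono fun _ h => h.symm)]
  exact hx.2 z' hz' p

omit [FiniteDimensional ℝ F] [T2Space M] in
lemma IsFraming.exists_eq_sum {U : Opens M} {A : SplitStructure F M}
    {V : Submodule ℝ ((p : M) → GT F p)} (hV : IsFraming U A V) {x : (q : M) → GT F q}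
    (hx : x ∈ sections U A.fiber) : ∃ (n : ℕ) (f : Fin n → M → ℝ) (v : Fin n → (q : M) → GT F q),
      (∀ i, f i ∈ smoothRing F ℝ U) ∧ (∀ i, v i ∈ V) ∧ ∀ q, x q = ∑ i, f i q • v i q := by
  rw [← hV.span_eq, Submodule.mem_span_set'] at hx
  obtain ⟨n, f, v, h⟩ := hx
  refine ⟨n, fun i => f i, fun i => v i, fun i => (f i).2, fun i => (v i).2, fun q => ?_⟩
  rw [← h, Finset.sum_apply]
  rfl

omit [FiniteDimensional ℝ F] [T2Space M] in
lemma IsFraming.mem_sections {U : Opens M} {A : SplitStructure F M}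
    {V : Submodule ℝ ((p : M) → GT F p)} (hV : IsFraming U A V) {v : (q : M) → GT F q}
    (hv : v ∈ V) : v ∈ sections U A.fiber :=
  hV.span_eq ▸ Submodule.subset_span hv

omit [FiniteDimensional ℝ F] [T2Space M] in
/-- A complex section is a combination of (real) elements of a framing with complex
coefficients. -/
lemma IsFraming.exists_eq_sum_complex {U : Opens M} {A : SplitStructure F M}
    {V : Submodule ℝ ((p : M) → GT F p)} (hV : IsFraming U A V) {z : (q : M) → CGT F q}
    (hre : (fun q => reC (z q)) ∈ sections U A.fiber)
    (him : (fun q => imC (z q)) ∈ sections U A.fiber) :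
    ∃ (ι : Type) (_ : Fintype ι) (f : ι → M → ℂ) (v : ι → (q : M) → GT F q),
      (∀ i, f i ∈ smoothRing F ℂ U) ∧ (∀ i, v i ∈ V) ∧
      ∀ q, z q = ∑ i, f i q • mkC (v i q) 0 := by
  obtain ⟨n, f, v, hf, hv, hfv⟩ := hV.exists_eq_sum hre
  obtain ⟨m, g, w, hg, hw, hgw⟩ := hV.exists_eq_sum him
  refine ⟨Fin n ⊕ Fin m, inferInstance, Sum.elim (fun i q => (f i q : ℂ))
    (fun i q => (g i q : ℂ) * Complex.I), Sum.elim v w, ?_, ?_, fun q => ?_⟩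
  · have key : ∀ f : M → ℝ, f ∈ smoothRing F ℝ U → (fun q => (f q : ℂ)) ∈ smoothRing F ℂ U :=
      fun f hf => Complex.ofRealCLM.contDiff.contMDiff.comp_contMDiffOn hf
    rintro (i | i)
    · exact key _ (hf i)
    · exact mul_mem (key _ (hg i)) (contMDiffOn_const (c := Complex.I))
  · rintro (i | i)
    · exact hv i
    · exact hw i
  · apply cgt_ext
    · simp only [hfv q, Fintype.sum_sum_type, Sum.elim_inl, Sum.elim_inr, map_add, map_sum,
        reC_smul, reC_mkC, imC_mkC, smul_zero, sub_zero, Complex.ofReal_re, Complex.re_ofReal_mul,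
        Complex.I_re, mul_zero, zero_smul, Finset.sum_const_zero, add_zero]
    · simp only [hgw q, Fintype.sum_sum_type, Sum.elim_inl, Sum.elim_inr, map_add, map_sum,
        imC_smul, reC_mkC, imC_mkC, smul_zero, zero_add, Complex.ofReal_im, Complex.im_ofReal_mul,
        Complex.I_im, mul_one, zero_smul, Finset.sum_const_zero]

/-- Germ version of `IsFraming.exists_eq_sum_complex`. -/
lemma IsFraming.exists_eventually_eq_sum {U : Opens M} {A : SplitStructure F M}
    {V : Submodule ℝ ((p : M) → GT F p)} (hV : IsFraming U A V) {p : M} (hp : p ∈ U)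
    {z : (q : M) → CGT F q} (hz : SmoothNearC p z)
    (hA : ∀ᶠ q in 𝓝 p, z q ∈ cFiber (A.fiber q)) :
    ∃ (ι : Type) (_ : Fintype ι) (f : ι → M → ℂ) (v : ι → (q : M) → GT F q),
      (∀ i, FunNear F p (f i)) ∧ (∀ i, v i ∈ V) ∧
      ∀ᶠ q in 𝓝 p, z q = ∑ i, f i q • mkC (v i q) 0 := by
  obtain ⟨x, hx, hxz⟩ := hz.1.exists_mem_sections (hA.mono fun _ h => h.1) hp
  obtain ⟨y, hy, hyz⟩ := hz.2.exists_mem_sections (hA.mono fun _ h => h.2) hp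
  obtain ⟨ι, i1, f, v, hf, hv, h⟩ := hV.exists_eq_sum_complex (z := fun q => mkC (x q) (y q))
    (by simpa only [reC_mkC] using hx) (by simpa only [imC_mkC] using hy)
  refine ⟨ι, i1, f, v, fun i => ⟨U, hp, hf i⟩, hv, ?_⟩
  filter_upwards [hxz, hyz] with q h1 h2
  rw [← h, h1, h2, mkC_reC_imC]

/-- A vector of `A` orthogonal to a framing of `A` vanishes. -/
lemma IsFraming.eq_zero_of_orthogonal {U : Opens M} {A : SplitStructure F M}
    {V : Submodule ℝ ((p : M) → GT F p)} (hV : IsFraming U A V) {p : M} (hp : p ∈ U)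
    {ξ : GT F p} (hξ : ξ ∈ A.fiber p) (h : ∀ v ∈ V, pair ξ (v p) = 0) : ξ = 0 := by
  refine A.eq_zero_of_orthogonal hξ fun η hη => ?_
  obtain ⟨x, hx, hxA, rfl⟩ := A.exists_extension hη
  obtain ⟨y, hy, hyx⟩ := hx.exists_mem_sections hxA hp
  obtain ⟨n, f, v, -, hv, hfv⟩ := hV.exists_eq_sum hy
  rw [← hyx.self_of_nhds, hfv, pair_comm, pair_sum_left]
  exact Finset.sum_eq_zero fun i _ => by rw [pair_smul_left, pair_comm, h _ (hv i), mul_zero]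

end Localization

/-! ### Frame derivatives and brackets of combinations -/

section Frames

variable {F : Type*} [NormedAddCommGroup F] [NormedSpace ℝ F]
  {M : Type*} [TopologicalSpace M] [ChartedSpace F M] [IsManifold 𝓘(ℝ, F) ∞ M]

lemma mvfderiv_apply_eq_zero {p : M} {B : Submodule ℝ (GT F p)} {f : M → ℝ}
    (hf : dSection f p ∈ B) {ξ : GT F p} (hξ : ∀ b ∈ B, pair ξ b = 0) :
    mvfderiv 𝓘(ℝ, F) f p ξ.1 = 0 := by
  have := hξ _ hf
  simp only [pair, dSection, map_zero, zero_add] at this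
  exact (div_eq_zero_iff.1 this).resolve_right two_ne_zero

lemma mvfderiv_sum_mul {p : M} {ι : Type*} (s : Finset ι) {f g : ι → M → ℝ}
    {v : TangentSpace 𝓘(ℝ, F) p} (hf : ∀ i, MDifferentiableAt 𝓘(ℝ, F) 𝓘(ℝ, ℝ) (f i) p)
    (hg : ∀ i, MDifferentiableAt 𝓘(ℝ, F) 𝓘(ℝ, ℝ) (g i) p)
    (hv : ∀ i, mvfderiv 𝓘(ℝ, F) (g i) p v = 0) :
    MDifferentiableAt 𝓘(ℝ, F) 𝓘(ℝ, ℝ) (fun q => ∑ i ∈ s, f i q * g i q) p ∧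
    mvfderiv 𝓘(ℝ, F) (fun q => ∑ i ∈ s, f i q * g i q) p v =
      ∑ i ∈ s, mvfderiv 𝓘(ℝ, F) (f i) p v * g i p := by
  classical
  induction s using Finset.induction_on with
  | empty =>
    simp only [Finset.sum_empty]
    exact ⟨mdifferentiableAt_const, by rw [mvfderiv_const]; rfl⟩
  | insert a s ha ih =>
    simp only [Finset.sum_insert ha]
    have h1 : MDifferentiableAt 𝓘(ℝ, F) 𝓘(ℝ, ℝ) (fun q => f a q * g a q) p := (hf a).mul (hg a)
    refine ⟨h1.add ih.1, ?_⟩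
    have h2 := mvfderiv_add h1 ih.1
    have h3 := mvfderiv_mul (hf a) (hg a)
    refine (DFunLike.congr_fun h2 v).trans ?_
    rw [add_apply, ih.2]
    congr 1
    refine (DFunLike.congr_fun h3 v).trans ?_
    simp only [add_apply, smul_apply, hv a, smul_eq_mul]
    ring

/-- The section `x - i J x` of `L_J` defined by a section `x` of `A`. -/
def SGF.lift {A : SplitStructure F M} (J : SGF A) (x : (q : M) → GT F q) (q : M) : CGT F q :=
  mkC (x q) (-J.toFun q (x q))

lemma SGF.smoothNearC_lift {A : SplitStructure F M} (J : SGF A) {p : M} {x : (q : M) → GT F q}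
    (hx : SmoothNear p x) : SmoothNearC p (J.lift x) :=
  SmoothNearC.mk hx (SmoothNear.apply J hx).neg

lemma SGF.lift_mem {A : SplitStructure F M} (J : SGF A) {q : M} {x : (q : M) → GT F q}
    (hx : x q ∈ A.fiber q) : J.lift x q ∈ J.eigen q := ⟨x q, hx, rfl⟩

/-- A combination lying in `L_J` equals its image under the projection `(1 - i J) / 2`. -/
lemma SGF.eq_sum_lift {A : SplitStructure F M} (J : SGF A) {q : M} {ι : Type*} [Fintype ι]
    {c : ι → ℂ} {w : ι → (q : M) → GT F q} (h : ∑ i, c i • mkC (w i q) 0 ∈ J.eigen q) :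
    ∑ i, c i • mkC (w i q) 0 = ∑ i, (c i * 2⁻¹) • J.lift (w i) q := by
  rw [J.mem_eigen] at h
  obtain ⟨h1, h2⟩ := h
  have h3 := J.apply_apply h1
  have h4 := congrArg (J.toFun q) h2
  rw [map_neg, h3] at h4
  simp only [map_sum, reC_smul, imC_smul, reC_mkC, imC_mkC, smul_zero, sub_zero, zero_add,
    map_smul] at h1 h2 h4
  have h5 : ∀ i, (c i * 2⁻¹) • J.lift (w i) q = (2⁻¹ : ℂ) • c i • J.lift (w i) q := fun i => by
    rw [smul_smul, mul_comm]
  simp only [h5, ← Finset.smul_sum]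
  rw [eq_comm, inv_smul_eq_iff₀ two_ne_zero, two_smul]
  apply cgt_ext
  · simp only [map_sum, map_add, SGF.lift, reC_smul, reC_mkC, imC_mkC, smul_zero, sub_zero,
      smul_neg, sub_neg_eq_add, Finset.sum_add_distrib, h4, neg_neg]
  · simp only [map_sum, map_add, SGF.lift, imC_smul, reC_mkC, imC_mkC, smul_zero, zero_add,
      smul_neg, Finset.sum_add_distrib, Finset.sum_neg_distrib, h2]

/-- If `d⟨w, w'⟩` and `d⟨J w, w'⟩` lie in `B` for all `w`, `w'` in the framing, then the
derivative in the direction of a vector orthogonal to `B` of the coefficients of a section of `L_J`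
again gives an element of `L_J`. -/
lemma IsFraming.sum_derivC_mem_eigen [FiniteDimensional ℝ F] [T2Space M]
    {A : SplitStructure F M} {J : SGF A} {p : M}
    {B : Submodule ℝ (GT F p)} {U : Opens M} {W : Submodule ℝ ((p : M) → GT F p)}
    (hW : IsFraming U A W) (hp : p ∈ U)
    (h0 : ∀ w ∈ W, ∀ z ∈ W, dSection (fun r => pair (w r) (z r)) p ∈ B)
    (hJ : ∀ w ∈ W, ∀ z ∈ W, dSection (fun r => pair (J.toFun r (w r)) (z r)) p ∈ B)
    {ι : Type*} [Fintype ι] {f : ι → M → ℂ} {w : ι → (q : M) → GT F q}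
    (hf : ∀ i, FunNear F p (f i)) (hw : ∀ i, w i ∈ W)
    (hz : ∀ᶠ q in 𝓝 p, ∑ i, f i q • mkC (w i q) 0 ∈ J.eigen q) {ζ : CGT F p}
    (hζ : ∀ b ∈ B, pair (reC ζ) b = 0 ∧ pair (imC ζ) b = 0) :
    ∑ i, derivC ζ (f i) • mkC (w i p) 0 ∈ J.eigen p := by
  have hws : ∀ v ∈ W, SmoothNear p v := fun v hv =>
    smoothNear_of_mem_sections (hW.mem_sections hv) hp
  have hwA : ∀ v ∈ W, v p ∈ A.fiber p := fun v hv => (hW.mem_sections hv).2.1 p hp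
  -- for a real direction, differentiate the components of `Im z = - J (Re z)` along the framing
  have key : ∀ ξ : GT F p, (∀ b ∈ B, pair ξ b = 0) →
      ∑ i, (⟨mvfderiv 𝓘(ℝ, F) (fun q => (f i q).re) p ξ.1,
        mvfderiv 𝓘(ℝ, F) (fun q => (f i q).im) p ξ.1⟩ : ℂ) • mkC (w i p) 0 ∈ J.eigen p := by
    intro ξ hξ
    rw [J.mem_eigen]
    simp only [map_sum, reC_smul, imC_smul, reC_mkC, imC_mkC, smul_zero, sub_zero, zero_add,
      map_smul]
    refine ⟨sum_mem fun i _ => (A.fiber p).smul_mem _ (hwA _ (hw i)), ?_⟩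
    rw [eq_neg_iff_add_eq_zero]
    refine hW.eq_zero_of_orthogonal hp (add_mem
      (sum_mem fun i _ => (A.fiber p).smul_mem _ (hwA _ (hw i)))
      (sum_mem fun i _ => (A.fiber p).smul_mem _ (J.mapsTo p _ (hwA _ (hw i))))) fun v hv => ?_
    simp only [pair_add_left, pair_sum_left, pair_smul_left]
    have e1 := mvfderiv_sum_mul Finset.univ (v := ξ.1) (fun i => (hf i).im.mdifferentiableAt)
      (fun i => (hws _ (hw i)).mdifferentiableAt_pair (hws v hv))
      (fun i => mvfderiv_apply_eq_zero (h0 _ (hw i) v hv) hξ)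
    have e2 := mvfderiv_sum_mul Finset.univ (v := ξ.1) (fun i => (hf i).re.mdifferentiableAt)
      (fun i => (SmoothNear.apply J (hws _ (hw i))).mdifferentiableAt_pair (hws v hv))
      (fun i => mvfderiv_apply_eq_zero (hJ _ (hw i) v hv) hξ)
    rw [← e1.2, ← e2.2]
    have e3 := DFunLike.congr_fun (mvfderiv_add e1.1 e2.1) ξ.1
    rw [add_apply] at e3
    rw [← e3]
    have e4 : ((fun q => ∑ i, (f i q).im * pair (w i q) (v q)) +
        fun q => ∑ i, (f i q).re * pair (J.toFun q (w i q)) (v q)) =ᶠ[𝓝 p] fun _ => 0 := by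
      filter_upwards [hz] with q hq
      rw [J.mem_eigen] at hq
      have := hq.2
      simp only [map_sum, reC_smul, imC_smul, reC_mkC, imC_mkC, smul_zero, sub_zero, zero_add,
        map_smul] at this
      rw [eq_neg_iff_add_eq_zero] at this
      have h5 := congrArg (fun x => pair x (v q)) this
      simp only [pair_add_left, pair_sum_left, pair_smul_left, pair_zero_left] at h5
      exact h5
    have e5 := congrArg Prod.snd (dSection_congr (F := F) e4)
    refine (DFunLike.congr_fun e5 ξ.1).trans ?_
    simp only [dSection, mvfderiv_const]
    rfl
  have h1 := add_mem (key (reC ζ) fun b hb => (hζ b hb).1)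
    ((J.eigen p).smul_mem Complex.I (key (imC ζ) fun b hb => (hζ b hb).2))
  rw [Finset.smul_sum, ← Finset.sum_add_distrib] at h1
  convert h1 using 2 with i
  rw [smul_smul, ← add_smul]
  congr 1
  apply Complex.ext <;> simp [derivC]; ring

variable [FiniteDimensional ℝ F]

lemma dorfmanC_sum_mem {p : M} {ι : Type*} [Fintype ι] {f : ι → M → ℂ}
    {z : (q : M) → CGT F q} {w : ι → (q : M) → CGT F q} (S : Submodule ℂ (CGT F p))
    (hz : SmoothNearC p z) (hf : ∀ i, FunNear F p (f i)) (hw : ∀ i, SmoothNearC p (w i))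
    (h : ∀ i, dorfmanC z (w i) p ∈ S) (h' : ∀ i, w i p ∈ S) :
    dorfmanC z (fun q => ∑ i, f i q • w i q) p ∈ S := by
  rw [dorfmanC_sum_smul_right Finset.univ hz (fun i _ => hf i) fun i _ => hw i]
  exact add_mem (sum_mem fun i _ => S.smul_mem _ (h i)) (sum_mem fun i _ => S.smul_mem _ (h' i))

lemma dorfmanC_mk_left {p : M} {a b : (q : M) → GT F q} {z : (q : M) → CGT F q}
    (hz : SmoothNearC p z) :
    dorfmanC (fun q => mkC (a q) (b q)) z p =
      dorfmanC (fun q => mkC (a q) 0) z p + Complex.I • dorfmanC (fun q => mkC (b q) 0) z p := by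
  rw [dorfmanC_real_left hz, dorfmanC_real_left hz]
  apply cgt_ext
  · simp only [dorfmanC, map_add, reC_mkC, imC_mkC, reC_smul, Complex.I_re, Complex.I_im]
    module
  · simp only [dorfmanC, map_add, reC_mkC, imC_mkC, imC_smul, Complex.I_re, Complex.I_im]
    module

end Frames

/-! ### The fibrewise linear algebra of a Morimoto datum -/

section Swap

variable {F : Type*} [NormedAddCommGroup F] [NormedSpace ℝ F]
  {M : Type*} [TopologicalSpace M] [ChartedSpace F M] [IsManifold 𝓘(ℝ, F) ∞ M]

/-- Transport of a split generalized `F`-structure to a split structure with the same fibres. -/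
def SGF.ofFiberEq {A B : SplitStructure F M} (J : SGF A) (h : ∀ p, A.fiber p = B.fiber p) :
    SGF B where
  toFun := J.toFun
  mapsTo p := h p ▸ J.mapsTo p
  extend_zero p := h p ▸ J.extend_zero p
  skew p := h p ▸ J.skew p
  orthogonal p := h p ▸ J.orthogonal p
  smooth := J.smooth

lemma SGF.eigenFiber_congr {A B : SplitStructure F M} {J : SGF A} {K : SGF B}
    (h : ∀ p, A.fiber p = B.fiber p) (hJ : ∀ p, J.toFun p = K.toFun p) (p : M) :
    J.eigenFiber p = K.eigenFiber p := by
  ext z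
  rw [J.mem_eigenFiber, K.mem_eigenFiber, h, hJ]

lemma SGF.eigenSections_congr {A B : SplitStructure F M} {J : SGF A} {K : SGF B}
    (h : ∀ p, J.eigenFiber p = K.eigenFiber p) : J.eigenSections = K.eigenSections := by
  ext z
  simp only [SGF.eigenSections, h]

lemma SGF.isCRF_congr {A B : SplitStructure F M} {J : SGF A} {K : SGF B}
    (h : ∀ p, J.eigenFiber p = K.eigenFiber p) : J.IsCRF ↔ K.IsCRF := by
  simp only [SGF.IsCRF, SGF.eigenSections_congr h, h]

lemma mkC_zero_mem_sectionsC {E : (p : M) → Submodule ℝ (GT F p)} {x : (q : M) → GT F q}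
    (hx : x ∈ sections ⊤ E) : (fun q => mkC (x q) 0) ∈ sectionsC E := by
  constructor
  · simpa only [reC_mkC] using hx
  · simp only [imC_mkC]
    exact zero_mem (sections ⊤ E)

namespace MorimotoDatum

variable (D : MorimotoDatum F M)

/-- The Morimoto datum with the two factors exchanged. -/
def swap : MorimotoDatum F M where
  E₁ := D.E₂
  E₂ := D.E₁
  E₁' := D.E₂'
  E₂' := D.E₁'
  orth₁₂ := D.orth₁₂.symm
  orth₁₁' := D.orth₂₂'
  orth₁₂' := D.orth₂₁'
  orth₂₁' := D.orth₁₂'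
  orth₂₂' := D.orth₁₁'
  orth₁'₂' := D.orth₁'₂'.symm
  J₁ := D.J₂
  J₂ := D.J₁
  V₁ := D.V₂
  V₂ := D.V₁
  Ψ := D.Ψ.ofFiberEq fun _ => sup_comm _ _
  framing₁ := D.framing₂
  framing₂ := D.framing₁
  normalizes₁ := D.normalizes₂.trans (Set.inter_comm _ _).le
  normalizes₂ := D.normalizes₁.trans (Set.inter_comm _ _).le
  localFraming₁ p := by
    obtain ⟨U, hU, W, hW, h⟩ := D.localFraming₂ p
    exact ⟨U, hU, W, hW, fun w hw => (h hw).symm⟩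
  localFraming₂ p := by
    obtain ⟨U, hU, W, hW, h⟩ := D.localFraming₁ p
    exact ⟨U, hU, W, hW, fun w hw => (h hw).symm⟩
  admissible := by
    obtain ⟨φ, h1, h2⟩ := D.admissible
    refine ⟨φ.symm, ?_, ?_⟩
    · ext w
      constructor
      · rintro ⟨e, he, rfl⟩
        rw [← h1] at he
        obtain ⟨e', he', hee⟩ := he
        have : e = φ e' := Subtype.ext hee
        rw [this, φ.symm_apply_apply]
        exact he'
      · intro hw
        have hw' : w ∈ sectionsC D.E₁'.fiber := by
          obtain ⟨x, hx, y, hy, rfl⟩ := hw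
          constructor
          · simpa only [reC_mkC] using D.framing₁.mem_sections hx
          · simpa only [imC_mkC] using D.framing₁.mem_sections hy
        refine ⟨φ ⟨w, hw'⟩, ?_, by rw [φ.symm_apply_apply]⟩
        rw [← h1]
        exact ⟨⟨w, hw'⟩, hw, rfl⟩
    · refine (SGF.eigenSections_congr (K := D.Ψ) (J := D.Ψ.ofFiberEq
        (B := D.E₂'.orthSum D.E₁' D.orth₁'₂'.symm) fun _ => sup_comm _ _)
        (SGF.eigenFiber_congr (fun _ => sup_comm _ _) fun _ => rfl)).trans (h2.trans ?_)
      ext z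
      constructor
      · rintro ⟨e, rfl⟩
        exact ⟨φ e, by rw [φ.symm_apply_apply, add_comm]⟩
      · rintro ⟨e, rfl⟩
        exact ⟨φ.symm e, by rw [φ.apply_symm_apply, add_comm]⟩

lemma swap_Ψ_eigenFiber (p : M) : D.swap.Ψ.eigenFiber p = D.Ψ.eigenFiber p :=
  SGF.eigenFiber_congr (J := D.swap.Ψ) (K := D.Ψ) (fun _ => sup_comm _ _) (fun _ => rfl) p

lemma swap_J_eigenFiber (p : M) : D.swap.J.eigenFiber p = D.J.eigenFiber p := by
  refine SGF.eigenFiber_congr (fun p => ?_) (fun p => ?_) p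
  · exact congrArg₂ (· ⊔ ·) (sup_comm _ _) (sup_comm _ _)
  · exact congrArg₂ (· + ·) (add_comm _ _) rfl

lemma hasAdaptedFramings_swap {A : SplitStructure F M} (J : SGF A) (B : SplitStructure F M) :
    D.swap.HasAdaptedFramings J B ↔ D.HasAdaptedFramings J B := by
  have h : ∀ U, D.swap.E₁''.normalizer U ∩ D.swap.E₂''.normalizer U =
      D.E₁''.normalizer U ∩ D.E₂''.normalizer U := fun U => Set.inter_comm _ _
  simp only [HasAdaptedFramings, h]

end MorimotoDatum
end Swap

namespace MorimotoDatum
section Fibres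

variable {F : Type*} [NormedAddCommGroup F] [NormedSpace ℝ F]
  {M : Type*} [TopologicalSpace M] [ChartedSpace F M] [IsManifold 𝓘(ℝ, F) ∞ M]
  (D : MorimotoDatum F M)

lemma orth'' : D.E₁''.Orthogonal D.E₂'' := by
  intro p x hx y hy
  obtain ⟨a, ha, b, hb, rfl⟩ := Submodule.mem_sup.1 hx
  obtain ⟨c, hc, d, hd, rfl⟩ := Submodule.mem_sup.1 hy
  simp only [pair_add_left, pair_add_right, D.orth₁₂ p a ha c hc, D.orth₁₂' p a ha d hd,
    D.orth₂₁'.symm p b hb c hc, D.orth₁'₂' p b hb d hd, add_zero]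

lemma E₁_le (p : M) : D.E₁.fiber p ≤ D.E₁''.fiber p := le_sup_left

lemma E₁'_le (p : M) : D.E₁'.fiber p ≤ D.E₁''.fiber p := le_sup_right

lemma E₂_le (p : M) : D.E₂.fiber p ≤ D.E₂''.fiber p := le_sup_left

lemma E₂'_le (p : M) : D.E₂'.fiber p ≤ D.E₂''.fiber p := le_sup_right

lemma J_apply (p : M) (x : GT F p) :
    D.J.toFun p x = D.J₁.toFun p x + D.J₂.toFun p x + D.Ψ.toFun p x := rfl

lemma J₁_eq_zero {p : M} {x : GT F p} (hx : ∀ y ∈ D.E₁.fiber p, pair y x = 0) :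
    D.J₁.toFun p x = 0 := D.J₁.extend_zero p x fun y hy => by rw [pair_comm, hx y hy]

lemma J₁_E₂ {p : M} {x : GT F p} (hx : x ∈ D.E₂.fiber p) : D.J₁.toFun p x = 0 :=
  D.J₁_eq_zero fun y hy => D.orth₁₂ p y hy x hx

lemma J₁_E₁' {p : M} {x : GT F p} (hx : x ∈ D.E₁'.fiber p) : D.J₁.toFun p x = 0 :=
  D.J₁_eq_zero fun y hy => D.orth₁₁' p y hy x hx

lemma J₁_E₂' {p : M} {x : GT F p} (hx : x ∈ D.E₂'.fiber p) : D.J₁.toFun p x = 0 :=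
  D.J₁_eq_zero fun y hy => D.orth₁₂' p y hy x hx

lemma J₂_E₁ {p : M} {x : GT F p} (hx : x ∈ D.E₁.fiber p) : D.J₂.toFun p x = 0 := D.swap.J₁_E₂ hx

lemma J₂_E₁' {p : M} {x : GT F p} (hx : x ∈ D.E₁'.fiber p) : D.J₂.toFun p x = 0 :=
  D.swap.J₁_E₂' hx

lemma J₂_E₂' {p : M} {x : GT F p} (hx : x ∈ D.E₂'.fiber p) : D.J₂.toFun p x = 0 :=
  D.swap.J₁_E₁' hx

lemma Ψ_E₁ {p : M} {x : GT F p} (hx : x ∈ D.E₁.fiber p) : D.Ψ.toFun p x = 0 :=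
  D.Ψ.extend_zero p x fun y hy => by
    obtain ⟨a, ha, b, hb, rfl⟩ := Submodule.mem_sup.1 hy
    rw [pair_add_right, D.orth₁₁' p x hx a ha, D.orth₁₂' p x hx b hb, add_zero]

lemma Ψ_E₂ {p : M} {x : GT F p} (hx : x ∈ D.E₂.fiber p) : D.Ψ.toFun p x = 0 := D.swap.Ψ_E₁ hx

lemma eigen_J₁_le (p : M) : D.J₁.eigen p ≤ D.J.eigen p := by
  intro z hz
  rw [SGF.mem_eigen] at hz ⊢
  refine ⟨Submodule.mem_sup_left (Submodule.mem_sup_left hz.1), ?_⟩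
  rw [J_apply, D.J₂_E₁ hz.1, D.Ψ_E₁ hz.1, hz.2, add_zero, add_zero]

lemma eigen_J₂_le (p : M) : D.J₂.eigen p ≤ D.J.eigen p := fun z hz => by
  have := D.swap.eigen_J₁_le p hz
  change z ∈ D.swap.J.eigenFiber p at this
  rwa [swap_J_eigenFiber] at this

lemma eigen_Ψ_le (p : M) : D.Ψ.eigen p ≤ D.J.eigen p := by
  intro z hz
  rw [SGF.mem_eigen] at hz ⊢
  obtain ⟨a, ha, b, hb, hab⟩ := Submodule.mem_sup.1 hz.1
  refine ⟨Submodule.mem_sup_right hz.1, ?_⟩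
  have h1 : D.J₁.toFun p (reC z) = 0 := by
    rw [← hab, map_add, D.J₁_E₁' ha, D.J₁_E₂' hb, add_zero]
  have h2 : D.J₂.toFun p (reC z) = 0 := by
    rw [← hab, map_add, D.J₂_E₁' ha, D.J₂_E₂' hb, add_zero]
  rw [J_apply, h1, h2, zero_add, zero_add, hz.2]

/-- `L_J ∩ (E₁' ⊕ E₂') ⊗ ℂ = L_Ψ`. -/
lemma mem_eigen_Ψ {p : M} {z : CGT F p} (hz : z ∈ D.J.eigen p)
    (h : z ∈ cFiber (D.E₁'.fiber p ⊔ D.E₂'.fiber p)) : z ∈ D.Ψ.eigen p := by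
  rw [SGF.mem_eigen] at hz ⊢
  obtain ⟨a, ha, b, hb, hab⟩ := Submodule.mem_sup.1 h.1
  refine ⟨h.1, ?_⟩
  have h1 : D.J₁.toFun p (reC z) = 0 := by
    rw [← hab, map_add, D.J₁_E₁' ha, D.J₁_E₂' hb, add_zero]
  have h2 : D.J₂.toFun p (reC z) = 0 := by
    rw [← hab, map_add, D.J₂_E₁' ha, D.J₂_E₂' hb, add_zero]
  rw [hz.2, J_apply, h1, h2, zero_add, zero_add]

/-- Admissibility, expressed fibrewise and on real elements of the framing `V₁`. -/
lemma admissible_spec : ∃ φ : sectionsC D.E₁'.fiber ≃ₗ[smoothRing F ℂ (⊤ : Opens M)]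
    sectionsC D.E₂'.fiber,
    (∀ v ∈ D.V₁, ∀ hv : (fun q => mkC (v q) 0) ∈ sectionsC D.E₁'.fiber,
      ∃ a ∈ D.V₂, ∃ b ∈ D.V₂, ∀ q, (φ ⟨_, hv⟩ : (p : M) → CGT F p) q = mkC (a q) (b q)) ∧
    (∀ (e : sectionsC D.E₁'.fiber) (q : M), (e : (p : M) → CGT F p) q +
      (φ e : (p : M) → CGT F p) q ∈ D.Ψ.eigen q) ∧
    ∀ z ∈ D.Ψ.eigenSections, ∃ e : sectionsC D.E₁'.fiber, ∀ q, z q = (e : (p : M) → CGT F p) q +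
      (φ e : (p : M) → CGT F p) q := by
  obtain ⟨φ, h1, h2⟩ := D.admissible
  refine ⟨φ, fun v hv hv' => ?_, fun e q => ?_, fun z hz => ?_⟩
  · have h3 : (φ ⟨_, hv'⟩ : (p : M) → CGT F p) ∈ complexSpan D.V₂ := by
      rw [← h1]
      exact ⟨⟨_, hv'⟩, ⟨v, hv, 0, zero_mem _, rfl⟩, rfl⟩
    obtain ⟨a, ha, b, hb, hab⟩ := h3
    exact ⟨a, ha, b, hb, fun q => congrFun hab q⟩
  · have h4 : (e : (p : M) → CGT F p) + (φ e : (p : M) → CGT F p) ∈ D.Ψ.eigenSections := by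
      rw [h2]
      exact ⟨e, rfl⟩
    exact h4.2 q
  · rw [h2] at hz
    obtain ⟨e, rfl⟩ := hz
    exact ⟨e, fun _ => rfl⟩

/-- Elements of a framing have a partner such that the sum is a section of `L_Ψ`. -/
lemma exists_graph {v : (q : M) → GT F q} (hv : v ∈ D.V₁) : ∃ a ∈ D.V₂, ∃ b ∈ D.V₂,
    ∀ q, mkC (v q) 0 + mkC (a q) (b q) ∈ D.Ψ.eigen q := by
  obtain ⟨φ, h1, h2, -⟩ := D.admissible_spec
  obtain ⟨a, ha, b, hb, h⟩ := h1 v hv (mkC_zero_mem_sectionsC (D.framing₁.mem_sections hv))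
  refine ⟨a, ha, b, hb, fun q => ?_⟩
  rw [← h]
  exact h2 _ q

set_option synthInstance.maxHeartbeats 200000 in
/-- The sections of `L_Ψ` are combinations of the `v + φ(v)` with `v ∈ V₁`. -/
lemma exists_sum_graph {z : (q : M) → CGT F q} (hz : z ∈ D.Ψ.eigenSections) :
    ∃ (ι : Type) (_ : Fintype ι) (f : ι → M → ℂ) (v a b : ι → (q : M) → GT F q),
      (∀ i, f i ∈ smoothRing F ℂ (⊤ : Opens M)) ∧ (∀ i, v i ∈ D.V₁) ∧ (∀ i, a i ∈ D.V₂) ∧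
      (∀ i, b i ∈ D.V₂) ∧ (∀ i q, mkC (v i q) 0 + mkC (a i q) (b i q) ∈ D.Ψ.eigen q) ∧
      ∀ q, z q = ∑ i, f i q • (mkC (v i q) 0 + mkC (a i q) (b i q)) := by
  obtain ⟨φ, h1, h2, h3⟩ := D.admissible_spec
  obtain ⟨e, hze⟩ := h3 z hz
  obtain ⟨ι, _, f, v, hf, hv, h⟩ := D.framing₁.exists_eq_sum_complex e.2.1 e.2.2
  let ε : ι → sectionsC D.E₁'.fiber := fun i =>
    ⟨_, mkC_zero_mem_sectionsC (D.framing₁.mem_sections (hv i))⟩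
  choose a ha b hb hab using fun i => h1 (v i) (hv i)
    (mkC_zero_mem_sectionsC (D.framing₁.mem_sections (hv i)))
  have he : e = ∑ i, (⟨f i, hf i⟩ : smoothRing F ℂ (⊤ : Opens M)) • ε i := by
    apply Subtype.ext
    funext q
    rw [h q, AddSubmonoidClass.coe_finsetSum, Finset.sum_apply]
    rfl
  have hφ : ∀ q, (φ e : (p : M) → CGT F p) q = ∑ i, f i q • mkC (a i q) (b i q) := fun q => by
    rw [he, map_sum, AddSubmonoidClass.coe_finsetSum, Finset.sum_apply]
    refine Finset.sum_congr rfl fun i _ => ?_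
    rw [map_smul]
    change f i q • (φ (ε i) : (p : M) → CGT F p) q = _
    rw [hab i]
  refine ⟨ι, inferInstance, f, v, a, b, hf, hv, ha, hb, fun i q => ?_, fun q => ?_⟩
  · rw [← hab]
    exact h2 _ q
  · simp only [smul_add, Finset.sum_add_distrib, ← h q, ← hφ q, hze q]

variable [FiniteDimensional ℝ F] [T2Space M]

/-- `L_Ψ` meets `E₁' ⊗ ℂ` trivially, because it is isotropic and projects onto `E₁' ⊗ ℂ`. -/
lemma eigen_Ψ_inter {p : M} {z : CGT F p} (hz : z ∈ D.Ψ.eigen p)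
    (h : z ∈ cFiber (D.E₁'.fiber p)) : z = 0 := by
  obtain ⟨φ, -, h2, -⟩ := D.admissible_spec
  have key : ∀ η ∈ D.E₁'.fiber p, pairC z (mkC η 0) = 0 := by
    intro η hη
    obtain ⟨x, hx, hxE, rfl⟩ := D.E₁'.exists_extension hη
    obtain ⟨y, hy, hyx⟩ := hx.exists_mem_sections hxE (U := ⊤) trivial
    have hy' := mkC_zero_mem_sectionsC hy
    have h5 : mkC (y p) 0 + (φ ⟨_, hy'⟩ : (p : M) → CGT F p) p ∈ D.Ψ.eigen p := h2 ⟨_, hy'⟩ p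
    have h6 := D.Ψ.pairC_eq_zero hz h5
    have h7 : (φ ⟨_, hy'⟩ : (p : M) → CGT F p) p ∈ cFiber (D.E₂'.fiber p) :=
      ⟨(φ ⟨_, hy'⟩).2.1.2.1 p trivial, (φ ⟨_, hy'⟩).2.2.2.1 p trivial⟩
    rwa [map_add, pairC_eq_zero_of_orthogonal (D.orth₁'₂' p) h h7, add_zero, hyx.self_of_nhds] at h6
  have key2 : ∀ η : GT F p, pairC z (mkC η 0) = ⟨pair (reC z) η, pair (imC z) η⟩ := fun η => by
    have h0 : ∀ x : GT F p, pair x 0 = 0 := fun x => by rw [pair_comm, pair_zero_left]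
    rw [pairC_apply, reC_mkC, imC_mkC, h0, h0, sub_zero, zero_add]
  apply cgt_ext
  · rw [map_zero]
    refine D.E₁'.eq_zero_of_orthogonal h.1 fun η hη => ?_
    have := key η hη
    rw [key2] at this
    exact congrArg Complex.re this
  · rw [map_zero]
    refine D.E₁'.eq_zero_of_orthogonal h.2 fun η hη => ?_
    have := key η hη
    rw [key2] at this
    exact congrArg Complex.im this

/-- `L_J ∩ E₁'' ⊗ ℂ = L_{J₁}`: the component in `E₁'` of an element of the intersection gives an
element of `L_Ψ ∩ E₁' ⊗ ℂ`, and hence vanishes. -/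
lemma mem_eigen_J₁ {p : M} {z : CGT F p} (hz : z ∈ D.J.eigen p)
    (h : z ∈ cFiber (D.E₁''.fiber p)) : z ∈ D.J₁.eigen p := by
  rw [SGF.mem_eigen] at hz ⊢
  obtain ⟨x, hx, x', hx', hxx⟩ := Submodule.mem_sup.1 h.1
  have hJ : D.J.toFun p (reC z) = D.J₁.toFun p x + D.Ψ.toFun p x' := by
    rw [J_apply, ← hxx, map_add, map_add, map_add, D.J₁_E₁' hx', D.J₂_E₁ hx, D.J₂_E₁' hx',
      D.Ψ_E₁ hx]
    abel
  have h1 : D.Ψ.toFun p x' ∈ D.E₁''.fiber p := by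
    have e : D.Ψ.toFun p x' = -(imC z + D.J₁.toFun p x) := by rw [hz.2, hJ]; abel
    rw [e]
    exact neg_mem (add_mem h.2 (D.E₁_le p (D.J₁.mapsTo p x hx)))
  obtain ⟨c, hc, d, hd, hcd⟩ := Submodule.mem_sup.1 (D.Ψ.mapsTo p x' (Submodule.mem_sup_left hx'))
  have hd0 : d = 0 := by
    have hd' : d ∈ D.E₁''.fiber p := by
      have e : d = D.Ψ.toFun p x' - c := by rw [← hcd]; abel
      rw [e]
      exact sub_mem h1 (D.E₁'_le p hc)
    exact D.E₂'.eq_zero_of_orthogonal hd fun y hy => D.orth'' p d hd' y (D.E₂'_le p hy)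
  rw [hd0, add_zero] at hcd
  have h2 : mkC x' (-D.Ψ.toFun p x') = 0 := by
    refine D.eigen_Ψ_inter ⟨x', Submodule.mem_sup_left hx', rfl⟩ ?_
    rw [mem_cFiber, reC_mkC, imC_mkC, ← hcd]
    exact ⟨hx', neg_mem hc⟩
  have h3 : x' = 0 := by
    have := congrArg reC h2
    rwa [reC_mkC, map_zero] at this
  rw [h3, map_zero, add_zero] at hJ
  rw [h3, add_zero] at hxx
  exact ⟨hxx ▸ hx, by rw [hz.2, hJ, hxx]⟩

end Fibres
end MorimotoDatum

namespace MorimotoDatum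

/-! ### Brackets in a Morimoto datum -/

section Brackets

variable {F : Type*} [NormedAddCommGroup F] [NormedSpace ℝ F] [FiniteDimensional ℝ F]
  {M : Type*} [TopologicalSpace M] [T2Space M] [ChartedSpace F M] [IsManifold 𝓘(ℝ, F) ∞ M]
  (D : MorimotoDatum F M) {p : M}

/-- `x` is smooth near `p` and its bracket at `p` with sections of `E₁''` and `E₂''` lies in `E₁''`
and `E₂''`, respectively. -/
structure Normalizes (p : M) (x : (q : M) → GT F q) : Prop where
  smooth : SmoothNear p x
  left : ∀ s, SmoothNear p s → (∀ᶠ q in 𝓝 p, s q ∈ D.E₁''.fiber q) → dorfman x s p ∈ D.E₁''.fiber p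
  right : ∀ s, SmoothNear p s → (∀ᶠ q in 𝓝 p, s q ∈ D.E₂''.fiber q) → dorfman x s p ∈ D.E₂''.fiber p

variable {D}

lemma Normalizes.swap {x : (q : M) → GT F q} (h : D.Normalizes p x) : D.swap.Normalizes p x :=
  ⟨h.smooth, h.right, h.left⟩

lemma normalizes_of_mem {U : Opens M} {x : (q : M) → GT F q}
    (hx : x ∈ D.E₁''.normalizer U ∩ D.E₂''.normalizer U) (hp : p ∈ U) : D.Normalizes p x where
  smooth := smoothNear_of_mem_sections hx.1.1 hp
  left _ hs hs' := SplitStructure.dorfman_mem_of_mem_normalizer hx.1 hp hs hs'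
  right _ hs hs' := SplitStructure.dorfman_mem_of_mem_normalizer hx.2 hp hs hs'

variable (D)

lemma normalizes_V₁ {v : (q : M) → GT F q} (hv : v ∈ D.V₁) (p : M) : D.Normalizes p v :=
  normalizes_of_mem (D.normalizes₁ hv) (U := ⊤) trivial

lemma normalizes_V₂ {v : (q : M) → GT F q} (hv : v ∈ D.V₂) (p : M) : D.Normalizes p v :=
  normalizes_of_mem (D.normalizes₂ hv) (U := ⊤) trivial

lemma mem_E₁' {v : (q : M) → GT F q} (hv : v ∈ D.V₁) (q : M) : v q ∈ D.E₁'.fiber q :=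
  (D.framing₁.mem_sections hv).2.1 q trivial

lemma mem_E₂' {v : (q : M) → GT F q} (hv : v ∈ D.V₂) (q : M) : v q ∈ D.E₂'.fiber q :=
  (D.framing₂.mem_sections hv).2.1 q trivial

variable {D}

/-- Normalizing sections of `E₁''` and of `E₂''` commute: the two brackets lie in `E₂''` and in
`E₁''`, and are opposite to each other. -/
lemma Normalizes.dorfman_eq_zero {x y : (q : M) → GT F q} (hx : D.Normalizes p x)
    (hy : D.Normalizes p y) (hxE : ∀ᶠ q in 𝓝 p, x q ∈ D.E₁''.fiber q)
    (hyE : ∀ᶠ q in 𝓝 p, y q ∈ D.E₂''.fiber q) : dorfman x y p = 0 ∧ dorfman y x p = 0 := by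
  have h1 := hx.right y hy.smooth hyE
  have h2 := hy.left x hx.smooth hxE
  have h3 := dorfman_add_dorfman_swap hx.smooth hy.smooth
  have h4 : ∀ᶠ q in 𝓝 p, pair (x q) (y q) = 0 := by
    filter_upwards [hxE, hyE] with q h5 h6 using D.orth'' q _ h5 _ h6
  have h5 : dSection (F := F) (fun _ : M => (0 : ℝ)) p = 0 := by
    simp only [dSection, mvfderiv_const]
    rfl
  rw [dSection_congr h4, h5, smul_zero] at h3
  have h6 : dorfman x y p ∈ D.E₁''.fiber p := by
    rw [eq_neg_of_add_eq_zero_left h3]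
    exact neg_mem h2
  have h7 : dorfman x y p = 0 := (Submodule.disjoint_def.1 (D.orth''.disjoint p)) _ h6 h1
  exact ⟨h7, by rwa [h7, zero_add] at h3⟩

lemma Normalizes.dorfmanC_mem {x : (q : M) → GT F q} (hx : D.Normalizes p x)
    {z : (q : M) → CGT F q} (hz : SmoothNearC p z)
    (hzE : ∀ᶠ q in 𝓝 p, z q ∈ cFiber (D.E₁''.fiber q)) :
    dorfmanC (fun q => mkC (x q) 0) z p ∈ cFiber (D.E₁''.fiber p) := by
  rw [dorfmanC_real_left hz, mem_cFiber, reC_mkC, imC_mkC]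
  exact ⟨hx.left _ hz.1 (hzE.mono fun _ h => h.1), hx.left _ hz.2 (hzE.mono fun _ h => h.2)⟩

/-- The inner products of normalizing sections of `E₁''` have differentials in `E₁''`. -/
lemma Normalizes.dSection_pair_mem {x y : (q : M) → GT F q} (hx : D.Normalizes p x)
    (hy : D.Normalizes p y) (hxE : ∀ᶠ q in 𝓝 p, x q ∈ D.E₁''.fiber q)
    (hyE : ∀ᶠ q in 𝓝 p, y q ∈ D.E₁''.fiber q) :
    dSection (fun q => pair (x q) (y q)) p ∈ D.E₁''.fiber p := by
  have h := add_mem (hx.left y hy.smooth hyE) (hy.left x hx.smooth hxE)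
  rw [dorfman_add_dorfman_swap hx.smooth hy.smooth] at h
  exact (Submodule.smul_mem_iff _ two_ne_zero).1 h

variable (D)

/-- The existence of adapted framings, expressed at `p`: sections of `L_{J₁}` are
combinations of normalizing sections `w` of `E₁` with `d⟨J₁ w, w'⟩ ∈ E₁''`, and derivatives of
their coefficients in directions orthogonal to `E₁''` again define elements of `L_{J₁}`. -/
lemma exists_adapted_sum (h : D.HasAdaptedFramings D.J₁ D.E₁'') {z : (q : M) → CGT F q}
    (hz : SmoothNearC p z) (hzJ : ∀ᶠ q in 𝓝 p, z q ∈ D.J₁.eigen q) :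
    ∃ (ι : Type) (_ : Fintype ι) (f : ι → M → ℂ) (w : ι → (q : M) → GT F q),
      (∀ i, FunNear F p (f i)) ∧ (∀ i, D.Normalizes p (w i)) ∧
      (∀ i, ∀ᶠ q in 𝓝 p, w i q ∈ D.E₁.fiber q) ∧
      (∀ᶠ q in 𝓝 p, z q = ∑ i, f i q • mkC (w i q) 0) ∧
      ∀ ζ ∈ cFiber (D.E₂''.fiber p), ∑ i, derivC ζ (f i) • mkC (w i p) 0 ∈ D.J₁.eigen p := by
  obtain ⟨U, hp, W, hW, hWn, hWJ⟩ := h p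
  obtain ⟨ι, _, f, w, hf, hw, hzw⟩ := hW.exists_eventually_eq_sum hp hz
    (hzJ.mono fun q h => D.J₁.eigen_le q h)
  have hn : ∀ w ∈ W, D.Normalizes p w := fun w hw => normalizes_of_mem (hWn hw) hp
  have hE : ∀ w ∈ W, ∀ᶠ q in 𝓝 p, w q ∈ D.E₁.fiber q := fun w hw =>
    eventually_mem_of_mem_sections (hW.mem_sections hw) hp
  refine ⟨ι, inferInstance, f, w, hf, fun i => hn _ (hw i), fun i => hE _ (hw i), hzw,
    fun ζ hζ => ?_⟩
  refine hW.sum_derivC_mem_eigen (B := D.E₁''.fiber p) hp (fun w hw z hz => ?_)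
    (fun w hw z hz => hWJ w hw z hz p hp) hf hw ?_ fun b hb => ?_
  · exact (hn w hw).dSection_pair_mem (hn z hz) ((hE w hw).mono fun q h => D.E₁_le q h)
      ((hE z hz).mono fun q h => D.E₁_le q h)
  · filter_upwards [hzJ, hzw] with q h1 h2
    rwa [h2] at h1
  · exact ⟨D.orth''.symm p _ hζ.1 b hb, D.orth''.symm p _ hζ.2 b hb⟩

/-- If `E₁` has adapted framings, then normalizing sections of `E₂''` normalize `L_{J₁}`. -/
lemma dorfmanC_mem_eigen_J₁ (h : D.HasAdaptedFramings D.J₁ D.E₁'') {y : (q : M) → GT F q}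
    (hy : D.Normalizes p y) (hyE : ∀ᶠ q in 𝓝 p, y q ∈ D.E₂''.fiber q) {z : (q : M) → CGT F q}
    (hz : SmoothNearC p z) (hzJ : ∀ᶠ q in 𝓝 p, z q ∈ D.J₁.eigen q) :
    dorfmanC (fun q => mkC (y q) 0) z p ∈ D.J₁.eigen p := by
  obtain ⟨ι, _, f, w, hf, hw, hwE, hzw, hd⟩ := D.exists_adapted_sum h hz hzJ
  have hy' : SmoothNearC p (fun q => mkC (y q) 0) := SmoothNearC.mk hy.smooth SmoothNear.zero
  have hw' : ∀ i, SmoothNearC p (fun q => mkC (w i q) 0) := fun i =>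
    SmoothNearC.mk (hw i).smooth SmoothNear.zero
  rw [dorfmanC_congr (Eventually.of_forall fun _ => rfl) hzw,
    dorfmanC_sum_smul_right Finset.univ hy' (fun i _ => hf i) fun i _ => hw' i]
  have h0 : ∀ i, dorfmanC (fun q => mkC (y q) 0) (fun q => mkC (w i q) 0) p = 0 := fun i => by
    rw [dorfmanC_real_left (hw' i)]
    simp only [reC_mkC, imC_mkC]
    rw [((hw i).dorfman_eq_zero hy ((hwE i).mono fun q h => D.E₁_le q h) hyE).2,
      dorfman_zero_right hy.smooth]
    simp [mkC]
  simp only [h0, smul_zero, Finset.sum_const_zero, zero_add]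
  exact hd _ (by rw [mem_cFiber, reC_mkC, imC_mkC]; exact ⟨hyE.self_of_nhds, zero_mem _⟩)

lemma dorfmanC_mem_eigen_J₁_of_V₂ (h : D.HasAdaptedFramings D.J₁ D.E₁'')
    {a b : (q : M) → GT F q} (ha : a ∈ D.V₂) (hb : b ∈ D.V₂) {z : (q : M) → CGT F q}
    (hz : SmoothNearC p z) (hzJ : ∀ᶠ q in 𝓝 p, z q ∈ D.J₁.eigen q) :
    dorfmanC (fun q => mkC (a q) (b q)) z p ∈ D.J₁.eigen p := by
  rw [dorfmanC_mk_left hz]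
  have hV : ∀ v ∈ D.V₂, ∀ᶠ q in 𝓝 p, v q ∈ D.E₂''.fiber q := fun v hv =>
    Eventually.of_forall fun q => D.E₂'_le q (D.mem_E₂' hv q)
  exact add_mem (D.dorfmanC_mem_eigen_J₁ h (D.normalizes_V₂ ha p) (hV a ha) hz hzJ)
    (Submodule.smul_mem _ _
      (D.dorfmanC_mem_eigen_J₁ h (D.normalizes_V₂ hb p) (hV b hb) hz hzJ))

/-- The bracket of the sections of `L_{J₁}` defined by two elements of an adapted framing lies in
`E₁'' ⊗ ℂ`. -/
lemma dorfmanC_lift_mem {U : Opens M} (hp : p ∈ U) {W : Submodule ℝ ((p : M) → GT F p)}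
    (hW : IsFraming U D.E₁ W) (hWn : ∀ w ∈ W, D.Normalizes p w)
    (hWJ : ∀ w ∈ W, ∀ z ∈ W, dSection (fun r => pair (D.J₁.toFun r (w r)) (z r)) p ∈ D.E₁''.fiber p)
    {w z : (q : M) → GT F q} (hw : w ∈ W) (hz : z ∈ W) :
    dorfmanC (D.J₁.lift w) (D.J₁.lift z) p ∈ cFiber (D.E₁''.fiber p) := by
  have hE : ∀ w ∈ W, ∀ᶠ q in 𝓝 p, w q ∈ D.E₁.fiber q := fun w hw =>
    eventually_mem_of_mem_sections (hW.mem_sections hw) hp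
  have hE'' : ∀ w ∈ W, ∀ᶠ q in 𝓝 p, w q ∈ D.E₁''.fiber q := fun w hw =>
    (hE w hw).mono fun q h => D.E₁_le q h
  have hJE : ∀ w ∈ W, ∀ᶠ q in 𝓝 p, D.J₁.toFun q (w q) ∈ D.E₁.fiber q := fun w hw =>
    (hE w hw).mono fun q h => D.J₁.mapsTo q _ h
  have hJs : ∀ w ∈ W, SmoothNear p (fun q => D.J₁.toFun q (w q)) := fun w hw =>
    SmoothNear.apply D.J₁ (hWn w hw).smooth
  have h1 : ∀ w ∈ W, ∀ z ∈ W, dorfman w (fun q => D.J₁.toFun q (z q)) p ∈ D.E₁''.fiber p :=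
    fun w hw z hz => (hWn w hw).left _ (hJs z hz) ((hJE z hz).mono fun q h => D.E₁_le q h)
  have h2 : ∀ w ∈ W, ∀ z ∈ W, dorfman (fun q => D.J₁.toFun q (w q)) z p ∈ D.E₁''.fiber p := by
    intro w hw z hz
    rw [eq_sub_of_add_eq (dorfman_add_dorfman_swap (hJs w hw) (hWn z hz).smooth)]
    exact sub_mem (Submodule.smul_mem _ _ (hWJ w hw z hz)) (h1 z hz w hw)
  -- expand `J z` in the framing to reduce `[J w, J z]` to the previous case
  have h3 : dorfman (fun q => D.J₁.toFun q (w q)) (fun q => D.J₁.toFun q (z q)) p ∈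
      D.E₁''.fiber p := by
    have hJw : SmoothNearC p (fun q => mkC (D.J₁.toFun q (w q)) 0) :=
      SmoothNearC.mk (hJs w hw) SmoothNear.zero
    have hJz : SmoothNearC p (fun q => mkC (D.J₁.toFun q (z q)) 0) :=
      SmoothNearC.mk (hJs z hz) SmoothNear.zero
    obtain ⟨ι, _, f, u, hf, hu, hfu⟩ := hW.exists_eventually_eq_sum hp hJz
      ((hJE z hz).mono fun q h => by
        rw [mem_cFiber, reC_mkC, imC_mkC]; exact ⟨h, zero_mem _⟩)
    have hus : ∀ i, SmoothNearC p (fun q => mkC (u i q) 0) := fun i =>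
      SmoothNearC.mk (hWn _ (hu i)).smooth SmoothNear.zero
    have h4 := dorfmanC_sum_mem (cFiber (D.E₁''.fiber p)) hJw hf hus (fun i => ?_) fun i => ?_
    · rw [← dorfmanC_congr (Eventually.of_forall fun _ => rfl) hfu, dorfmanC_real_left hJz,
        mem_cFiber, reC_mkC] at h4
      simpa only [reC_mkC] using h4.1
    · rw [dorfmanC_real_left (hus i), mem_cFiber, reC_mkC, imC_mkC]
      simp only [reC_mkC, imC_mkC, dorfman_zero_right (hJs w hw)]
      exact ⟨h2 w hw _ (hu i), zero_mem _⟩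
    · rw [mem_cFiber, reC_mkC, imC_mkC]
      exact ⟨(hE'' _ (hu i)).self_of_nhds, zero_mem _⟩
  have hJn : ∀ w ∈ W, SmoothNear p (fun q => -D.J₁.toFun q (w q)) := fun w hw => (hJs w hw).neg
  rw [mem_cFiber]
  simp only [dorfmanC, SGF.lift, reC_mkC, imC_mkC]
  rw [dorfman_neg_left (hJs w hw) (hJn z hz), dorfman_neg_right (hJs w hw) (hJs z hz),
    dorfman_neg_right (hWn w hw).smooth (hJs z hz), dorfman_neg_left (hJs w hw) (hWn z hz).smooth,
    neg_neg]
  exact ⟨sub_mem ((hWn w hw).left z (hWn z hz).smooth (hE'' z hz)) h3,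
    add_mem (neg_mem (h1 w hw z hz)) (neg_mem (h2 w hw z hz))⟩

/-- If `E₁` has adapted framings, then the brackets of sections of `L_{J₁}` lie in `E₁'' ⊗ ℂ`. -/
lemma dorfmanC_mem_cFiber (h : D.HasAdaptedFramings D.J₁ D.E₁'') {z w : (q : M) → CGT F q}
    (hz : SmoothNearC p z) (hzJ : ∀ᶠ q in 𝓝 p, z q ∈ D.J₁.eigen q)
    (hw : SmoothNearC p w) (hwJ : ∀ᶠ q in 𝓝 p, w q ∈ D.J₁.eigen q) :
    dorfmanC z w p ∈ cFiber (D.E₁''.fiber p) := by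
  obtain ⟨U, hp, W, hW, hWn, hWJ⟩ := h p
  have hn : ∀ w ∈ W, D.Normalizes p w := fun w hw => normalizes_of_mem (hWn hw) hp
  have hE : ∀ w ∈ W, ∀ᶠ q in 𝓝 p, w q ∈ D.E₁.fiber q := fun w hw =>
    eventually_mem_of_mem_sections (hW.mem_sections hw) hp
  have hl : ∀ w ∈ W, SmoothNearC p (D.J₁.lift w) := fun w hw =>
    D.J₁.smoothNearC_lift (hn w hw).smooth
  have hlJ : ∀ w ∈ W, ∀ᶠ q in 𝓝 p, D.J₁.lift w q ∈ D.J₁.eigen q := fun w hw =>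
    (hE w hw).mono fun q h => D.J₁.lift_mem h
  have hlE : ∀ w ∈ W, D.J₁.lift w p ∈ cFiber (D.E₁''.fiber p) := fun w hw => by
    have := D.J₁.eigen_le p (hlJ w hw).self_of_nhds
    exact ⟨D.E₁_le p this.1, D.E₁_le p this.2⟩
  -- sections of `L_{J₁}` are combinations of lifts of elements of the framing
  have hsum : ∀ z : (q : M) → CGT F q, SmoothNearC p z → (∀ᶠ q in 𝓝 p, z q ∈ D.J₁.eigen q) →
      ∃ (ι : Type) (_ : Fintype ι) (f : ι → M → ℂ) (w : ι → (q : M) → GT F q),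
        (∀ i, FunNear F p (f i)) ∧ (∀ i, w i ∈ W) ∧
        ∀ᶠ q in 𝓝 p, z q = ∑ i, f i q • D.J₁.lift (w i) q := by
    intro z hz hzJ
    obtain ⟨ι, _, f, w, hf, hw, hzw⟩ := hW.exists_eventually_eq_sum hp hz
      (hzJ.mono fun q h => D.J₁.eigen_le q h)
    refine ⟨ι, inferInstance, fun i q => f i q * 2⁻¹, w, fun i => ?_, hw, ?_⟩
    · obtain ⟨O, hO, hfO⟩ := hf i
      exact ⟨O, hO, (smoothRing F ℂ O).mul_mem hfO (contMDiffOn_const (c := (2⁻¹ : ℂ)))⟩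
    · filter_upwards [hzJ, hzw] with q h1 h2
      rw [h2] at h1
      rw [h2, D.J₁.eq_sum_lift h1]
  have hiso : ∀ z w : (q : M) → CGT F q, (∀ᶠ q in 𝓝 p, z q ∈ D.J₁.eigen q) →
      (∀ᶠ q in 𝓝 p, w q ∈ D.J₁.eigen q) → ∀ᶠ q in 𝓝 p, pairC (z q) (w q) = 0 := by
    intro z w hz hw
    filter_upwards [hz, hw] with q h1 h2 using D.J₁.pairC_eq_zero h1 h2
  have key : ∀ u ∈ W, dorfmanC (D.J₁.lift u) z p ∈ cFiber (D.E₁''.fiber p) := by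
    intro u hu
    obtain ⟨ι, _, f, v, hf, hv, hzv⟩ := hsum z hz hzJ
    rw [dorfmanC_congr (Eventually.of_forall fun _ => rfl) hzv]
    exact dorfmanC_sum_mem _ (hl u hu) hf (fun i => hl _ (hv i))
      (fun i => D.dorfmanC_lift_mem hp hW hn (fun w hw z hz => hWJ w hw z hz p hp) hu (hv i))
      fun i => hlE _ (hv i)
  obtain ⟨ι, _, f, v, hf, hv, hwv⟩ := hsum w hw hwJ
  rw [dorfmanC_congr (Eventually.of_forall fun _ => rfl) hwv]
  refine dorfmanC_sum_mem _ hz hf (fun i => hl _ (hv i)) (fun i => ?_) fun i => hlE _ (hv i)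
  rw [dorfmanC_swap hz (hl _ (hv i)) (hiso _ _ hzJ (hlJ _ (hv i)))]
  exact neg_mem (key _ (hv i))

/-- If `J₁` is a generalized CRF-structure, every normalizing local framing is adapted: the
imaginary part of `[w - i J w, z - i J z]` is `-([w, J z] + [J w, z])`, where `[w, J z]` lies in
`E₁''` and `[J w, z]` differs from an element of `E₁''` by a multiple of `d⟨J w, z⟩`. -/
lemma hasAdaptedFramings_of_isCRF (h : D.J₁.IsCRF) : D.HasAdaptedFramings D.J₁ D.E₁'' := by
  intro p
  obtain ⟨U, hp, W, hW, hWn⟩ := D.localFraming₁ p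
  refine ⟨U, hp, W, hW, hWn, fun w hw z hz q hq => ?_⟩
  have hn : ∀ w ∈ W, D.Normalizes q w := fun w hw => normalizes_of_mem (hWn hw) hq
  have hE : ∀ w ∈ W, ∀ᶠ q in 𝓝 q, w q ∈ D.E₁.fiber q := fun w hw =>
    eventually_mem_of_mem_sections (hW.mem_sections hw) hq
  have hJE : ∀ w ∈ W, ∀ᶠ q in 𝓝 q, D.J₁.toFun q (w q) ∈ D.E₁''.fiber q := fun w hw =>
    (hE w hw).mono fun q h => D.E₁_le q (D.J₁.mapsTo q _ h)
  have hJs : ∀ w ∈ W, SmoothNear q (fun q => D.J₁.toFun q (w q)) := fun w hw =>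
    SmoothNear.apply D.J₁ (hn w hw).smooth
  have h1 := h.dorfmanC_mem (D.J₁.smoothNearC_lift (hn w hw).smooth)
    (D.J₁.smoothNearC_lift (hn z hz).smooth) ((hE w hw).mono fun q h => D.J₁.lift_mem h)
    ((hE z hz).mono fun q h => D.J₁.lift_mem h)
  have h2 := D.E₁_le q (D.J₁.eigen_le q h1).2
  simp only [dorfmanC, SGF.lift, reC_mkC, imC_mkC] at h2
  rw [dorfman_neg_right (hn w hw).smooth (hJs z hz), dorfman_neg_left (hJs w hw) (hn z hz).smooth,
    ← neg_add, neg_mem_iff] at h2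
  have h3 := (Submodule.add_mem_iff_right _ ((hn w hw).left _ (hJs z hz) (hJE z hz))).1 h2
  have h4 := add_mem h3 ((hn z hz).left _ (hJs w hw) (hJE w hw))
  rw [dorfman_add_dorfman_swap (hJs w hw) (hn z hz).smooth] at h4
  exact (Submodule.smul_mem_iff _ two_ne_zero).1 h4

end Brackets
end MorimotoDatum

namespace MorimotoDatum

/-! ### From the sum to the summands -/

section Forward

variable {F : Type*} [NormedAddCommGroup F] [NormedSpace ℝ F] [FiniteDimensional ℝ F]
  {M : Type*} [TopologicalSpace M] [T2Space M] [ChartedSpace F M] [IsManifold 𝓘(ℝ, F) ∞ M]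
  (D : MorimotoDatum F M) {p : M}

lemma smoothNearC_real {v : (q : M) → GT F q} (h : D.Normalizes p v) :
    SmoothNearC p (fun q => mkC (v q) 0) := SmoothNearC.mk h.smooth SmoothNear.zero

lemma smoothNearC_mk {a b : (q : M) → GT F q} (ha : a ∈ D.V₂) (hb : b ∈ D.V₂) (p : M) :
    SmoothNearC p (fun q => mkC (a q) (b q)) :=
  SmoothNearC.mk (D.normalizes_V₂ ha p).smooth (D.normalizes_V₂ hb p).smooth

lemma dorfman_V₁_V₂ {v a : (q : M) → GT F q} (hv : v ∈ D.V₁) (ha : a ∈ D.V₂) (p : M) :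
    dorfman v a p = 0 ∧ dorfman a v p = 0 :=
  (D.normalizes_V₁ hv p).dorfman_eq_zero (D.normalizes_V₂ ha p)
    (Eventually.of_forall fun q => D.E₁'_le q (D.mem_E₁' hv q))
    (Eventually.of_forall fun q => D.E₂'_le q (D.mem_E₂' ha q))

/-- The brackets of elements of `L_Ψ` of the form `v + φ(v)`: the mixed terms vanish, since `V₁` and
`V₂` commute. -/
lemma dorfmanC_graph {v v' a b a' b' : (q : M) → GT F q} (hv : v ∈ D.V₁) (hv' : v' ∈ D.V₁)
    (ha : a ∈ D.V₂) (hb : b ∈ D.V₂) (ha' : a' ∈ D.V₂) (hb' : b' ∈ D.V₂) (p : M) :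
    dorfmanC (fun q => mkC (v q) 0 + mkC (a q) (b q))
        (fun q => mkC (v' q) 0 + mkC (a' q) (b' q)) p =
      mkC (dorfman v v' p) 0 +
        mkC (dorfman a a' p - dorfman b b' p) (dorfman a b' p + dorfman b a' p) := by
  have hs := D.smoothNearC_real (D.normalizes_V₁ hv p)
  have hs' := D.smoothNearC_real (D.normalizes_V₁ hv' p)
  have ht := D.smoothNearC_mk ha hb p
  have ht' := D.smoothNearC_mk ha' hb' p
  rw [dorfmanC_add_left hs ht (hs'.add ht'), dorfmanC_add_right hs hs' ht',
    dorfmanC_add_right ht hs' ht', dorfmanC_real_left hs', dorfmanC_real_left ht']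
  simp only [dorfmanC, reC_mkC, imC_mkC]
  rw [dorfman_zero_right (D.normalizes_V₁ hv p).smooth, (D.dorfman_V₁_V₂ hv ha' p).1,
    (D.dorfman_V₁_V₂ hv hb' p).1, (D.dorfman_V₁_V₂ hv' ha p).2, (D.dorfman_V₁_V₂ hv' hb p).2,
    dorfman_zero_right (D.normalizes_V₂ ha p).smooth,
    dorfman_zero_right (D.normalizes_V₂ hb p).smooth]
  have h0 : mkC (0 : GT F p) 0 = 0 := by simp [mkC]
  simp only [sub_zero, add_zero, zero_add, h0]

lemma dorfman_V₂_mem {a b : (q : M) → GT F q} (ha : a ∈ D.V₂) (hb : b ∈ D.V₂) (p : M) :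
    dorfman a b p ∈ D.E₂''.fiber p :=
  (D.normalizes_V₂ ha p).right b (D.normalizes_V₂ hb p).smooth
    (Eventually.of_forall fun q => D.E₂'_le q (D.mem_E₂' hb q))

lemma dorfman_V₁_mem {a b : (q : M) → GT F q} (ha : a ∈ D.V₁) (hb : b ∈ D.V₁) (p : M) :
    dorfman a b p ∈ D.E₁''.fiber p := D.swap.dorfman_V₂_mem ha hb p

/-- If `J` is a generalized CRF-structure, then `[v, v'] ∈ E₁'` for `v, v' ∈ V₁`: the bracket of
`v + φ(v)` and `v' + φ(v')` is `[v, v'] + [φ(v), φ(v')]`, so the component of `[v, v']` in `E₁` is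
a real element of `L_{J₁}`, hence zero. -/
lemma dorfman_mem_E₁' (hJ : D.J.IsCRF) {v v' : (q : M) → GT F q} (hv : v ∈ D.V₁)
    (hv' : v' ∈ D.V₁) (p : M) : dorfman v v' p ∈ D.E₁'.fiber p := by
  obtain ⟨a, ha, b, hb, h⟩ := D.exists_graph hv
  obtain ⟨a', ha', b', hb', h'⟩ := D.exists_graph hv'
  have h1 := hJ.dorfmanC_mem (p := p)
    ((D.smoothNearC_real (D.normalizes_V₁ hv p)).add (D.smoothNearC_mk ha hb p))
    ((D.smoothNearC_real (D.normalizes_V₁ hv' p)).add (D.smoothNearC_mk ha' hb' p))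
    (Eventually.of_forall fun q => D.eigen_Ψ_le q (h q))
    (Eventually.of_forall fun q => D.eigen_Ψ_le q (h' q))
  rw [D.dorfmanC_graph hv hv' ha hb ha' hb', SGF.mem_eigen] at h1
  have h2 := h1.2
  simp only [map_add, reC_mkC, imC_mkC, zero_add] at h2
  have hc : dorfman a a' p - dorfman b b' p ∈ D.E₂''.fiber p :=
    sub_mem (D.dorfman_V₂_mem ha ha' p) (D.dorfman_V₂_mem hb hb' p)
  have hd : dorfman a b' p + dorfman b a' p ∈ D.E₂''.fiber p :=
    add_mem (D.dorfman_V₂_mem ha hb' p) (D.dorfman_V₂_mem hb ha' p)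
  obtain ⟨x, hx, x', hx', hxx⟩ := Submodule.mem_sup.1 (D.dorfman_V₁_mem hv hv' p)
  obtain ⟨y, hy, y', hy', hyy⟩ := Submodule.mem_sup.1 hc
  have hΨ : D.Ψ.toFun p (x' + y') ∈ D.E₁'.fiber p ⊔ D.E₂'.fiber p :=
    D.Ψ.mapsTo p _ (Submodule.add_mem_sup hx' hy')
  have e1 : D.J.toFun p (x + x') + D.J.toFun p (y + y') =
      D.J₁.toFun p x + (D.J₂.toFun p y + D.Ψ.toFun p (x' + y')) := by
    simp only [J_apply, map_add, D.J₁_E₁' hx', D.J₂_E₁ hx, D.J₂_E₁' hx', D.Ψ_E₁ hx, D.J₁_E₂ hy,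
      D.J₁_E₂' hy', D.J₂_E₂' hy', D.Ψ_E₂ hy]
    abel
  rw [← hxx, ← hyy, e1] at h2
  have h3 : D.J₁.toFun p x = 0 := by
    refine D.E₁.eq_zero_of_orthogonal (D.J₁.mapsTo p x hx) fun u hu => ?_
    have e2 : D.J₁.toFun p x = -(dorfman a b' p + dorfman b a' p) - D.J₂.toFun p y -
        D.Ψ.toFun p (x' + y') := by rw [h2]; abel
    obtain ⟨s, hs, t, ht, hst⟩ := Submodule.mem_sup.1 hΨ
    rw [e2, pair_sub_left, pair_sub_left, pair_neg_left,
      D.orth''.symm p _ hd u (D.E₁_le p hu),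
      D.orth₁₂.symm p _ (D.J₂.mapsTo p y hy) u hu, ← hst, pair_add_left,
      D.orth₁₁'.symm p s hs u hu, D.orth₁₂'.symm p t ht u hu]
    ring
  have h4 := D.J₁.apply_apply hx
  rw [h3, map_zero, eq_comm, neg_eq_zero] at h4
  rw [← hxx, h4, zero_add]
  exact hx'

/-- If `J` is a generalized CRF-structure and `E₁` has adapted framings, then `(J₁, V₁)` is a
normal pair. -/
lemma isNormalPair_of_isCRF (hJ : D.J.IsCRF) (h : D.HasAdaptedFramings D.J₁ D.E₁'') :
    IsNormalPair D.J₁ D.E₁' D.V₁ where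
  orth := D.orth₁₁'.symm
  isCRF z hz w hw p := by
    have hzJ : ∀ᶠ q in 𝓝 p, z q ∈ D.J₁.eigen q := Eventually.of_forall hz.2
    have hwJ : ∀ᶠ q in 𝓝 p, w q ∈ D.J₁.eigen q := Eventually.of_forall hw.2
    have hzs := SGF.smoothNearC_of_mem hz p
    have hws := SGF.smoothNearC_of_mem hw p
    exact D.mem_eigen_J₁ (hJ.dorfmanC_mem hzs hws (hzJ.mono fun q h => D.eigen_J₁_le q h)
      (hwJ.mono fun q h => D.eigen_J₁_le q h)) (D.dorfmanC_mem_cFiber h hzs hzJ hws hwJ)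
  framing := D.framing₁
  normalizes v hv := by
    have hvs : v ∈ sections ⊤ (fun p : M => (⊤ : Submodule ℝ (GT F p))) :=
      ⟨(D.framing₁.mem_sections hv).1, fun _ _ => trivial, fun q hq => (hq trivial).elim⟩
    refine ⟨⟨hvs, fun z hz p => ?_⟩, ⟨hvs, fun s hs p _ => ?_⟩⟩
    · obtain ⟨a, ha, b, hb, hab⟩ := D.exists_graph hv
      have hzJ : ∀ᶠ q in 𝓝 p, z q ∈ D.J₁.eigen q := Eventually.of_forall hz.2
      have hzs := SGF.smoothNearC_of_mem hz p
      have hvn := D.normalizes_V₁ hv p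
      have h1 := hJ.dorfmanC_mem (p := p) ((D.smoothNearC_real hvn).add (D.smoothNearC_mk ha hb p))
        hzs (Eventually.of_forall fun q => D.eigen_Ψ_le q (hab q))
        (hzJ.mono fun q h => D.eigen_J₁_le q h)
      rw [dorfmanC_add_left (D.smoothNearC_real hvn) (D.smoothNearC_mk ha hb p) hzs] at h1
      have h2 := D.eigen_J₁_le p (D.dorfmanC_mem_eigen_J₁_of_V₂ h ha hb hzs hzJ)
      refine D.mem_eigen_J₁ ((Submodule.add_mem_iff_left _ h2).1 h1) (hvn.dorfmanC_mem hzs ?_)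
      filter_upwards [hzJ] with q hq
      exact ⟨D.E₁_le q (D.J₁.eigen_le q hq).1, D.E₁_le q (D.J₁.eigen_le q hq).2⟩
    · have hvn := D.normalizes_V₁ hv p
      have hs' := mkC_zero_mem_sectionsC hs
      obtain ⟨ι, _, f, w, hf, hw, hsw⟩ := D.framing₁.exists_eq_sum_complex hs'.1 hs'.2
      have h1 : dorfmanC (fun q => mkC (v q) 0) (fun q => mkC (s q) 0) p ∈
          cFiber (D.E₁'.fiber p) := by
        rw [dorfmanC_congr (Eventually.of_forall fun _ => rfl) (Eventually.of_forall hsw)]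
        refine dorfmanC_sum_mem _ (D.smoothNearC_real hvn) (fun i => ⟨⊤, trivial, hf i⟩)
          (fun i => D.smoothNearC_real (D.normalizes_V₁ (hw i) p)) (fun i => ?_) fun i => ?_
        · rw [dorfmanC_real_left (D.smoothNearC_real (D.normalizes_V₁ (hw i) p)), mem_cFiber]
          simp only [reC_mkC, imC_mkC, dorfman_zero_right hvn.smooth]
          exact ⟨D.dorfman_mem_E₁' hJ hv (hw i) p, zero_mem _⟩
        · rw [mem_cFiber, reC_mkC, imC_mkC]
          exact ⟨D.mem_E₁' (hw i) p, zero_mem _⟩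
      rw [dorfmanC_real_left (SmoothNearC.mk (smoothNear_of_mem_sections hs trivial)
        SmoothNear.zero), mem_cFiber, reC_mkC] at h1
      simpa only [reC_mkC] using h1.1

/-- `Ψ` is a generalized CRF-structure if `J` is one: since `[V₁, V₁]` lies in `E₁'` and `[V₂, V₂]`
in `E₂'`, the brackets of the generators `v + φ(v)` of `L_Ψ` lie in `(E₁' ⊕ E₂') ⊗ ℂ`, which meets
`L_J` in `L_Ψ`. -/
lemma isCRF_Ψ (hJ : D.J.IsCRF) : D.Ψ.IsCRF := by
  have hJ' : D.swap.J.IsCRF := (SGF.isCRF_congr D.swap_J_eigenFiber).2 hJ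
  intro z hz w hw p
  have hzs := SGF.smoothNearC_of_mem hz p
  have hws := SGF.smoothNearC_of_mem hw p
  have h1 := hJ.dorfmanC_mem hzs hws (Eventually.of_forall fun q => D.eigen_Ψ_le q (hz.2 q))
    (Eventually.of_forall fun q => D.eigen_Ψ_le q (hw.2 q))
  refine D.mem_eigen_Ψ h1 ?_
  obtain ⟨ι, _, f, v, a, b, hf, hv, ha, hb, hvab, hzv⟩ := D.exists_sum_graph hz
  obtain ⟨κ, _, g, v', a', b', hg, hv', ha', hb', hvab', hwv⟩ := D.exists_sum_graph hw
  have hs : ∀ {v a b : (q : M) → GT F q}, v ∈ D.V₁ → a ∈ D.V₂ → b ∈ D.V₂ →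
      SmoothNearC p (fun q => mkC (v q) 0 + mkC (a q) (b q)) := fun hv ha hb =>
    (D.smoothNearC_real (D.normalizes_V₁ hv p)).add (D.smoothNearC_mk ha hb p)
  have hE : ∀ {v a b : (q : M) → GT F q}, v ∈ D.V₁ → a ∈ D.V₂ → b ∈ D.V₂ →
      mkC (v p) 0 + mkC (a p) (b p) ∈ cFiber (D.E₁'.fiber p ⊔ D.E₂'.fiber p) := by
    intro v a b hv ha hb
    rw [mem_cFiber, map_add, map_add, reC_mkC, reC_mkC, imC_mkC, imC_mkC]
    exact ⟨Submodule.add_mem_sup (D.mem_E₁' hv p) (D.mem_E₂' ha p),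
      add_mem (zero_mem _) (Submodule.mem_sup_right (D.mem_E₂' hb p))⟩
  have key : ∀ j, dorfmanC (fun q => mkC (v' j q) 0 + mkC (a' j q) (b' j q)) z p ∈
      cFiber (D.E₁'.fiber p ⊔ D.E₂'.fiber p) := by
    intro j
    rw [dorfmanC_congr (Eventually.of_forall fun _ => rfl) (Eventually.of_forall hzv)]
    refine dorfmanC_sum_mem _ (hs (hv' j) (ha' j) (hb' j)) (fun i => ⟨⊤, trivial, hf i⟩)
      (fun i => hs (hv i) (ha i) (hb i)) (fun i => ?_) fun i => hE (hv i) (ha i) (hb i)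
    rw [D.dorfmanC_graph (hv' j) (hv i) (ha' j) (hb' j) (ha i) (hb i), mem_cFiber]
    have h2 : ∀ {x y : (q : M) → GT F q}, x ∈ D.V₂ → y ∈ D.V₂ →
        dorfman x y p ∈ D.E₁'.fiber p ⊔ D.E₂'.fiber p := fun hx hy =>
      Submodule.mem_sup_right (D.swap.dorfman_mem_E₁' hJ' hx hy p)
    simp only [map_add, reC_mkC, imC_mkC]
    exact ⟨add_mem (Submodule.mem_sup_left (D.dorfman_mem_E₁' hJ (hv' j) (hv i) p))
      (sub_mem (h2 (ha' j) (ha i)) (h2 (hb' j) (hb i))),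
      add_mem (zero_mem _) (add_mem (h2 (ha' j) (hb i)) (h2 (hb' j) (ha i)))⟩
  rw [dorfmanC_congr (Eventually.of_forall fun _ => rfl) (Eventually.of_forall hwv)]
  refine dorfmanC_sum_mem _ hzs (fun i => ⟨⊤, trivial, hg i⟩)
    (fun i => hs (hv' i) (ha' i) (hb' i)) (fun i => ?_) fun i => hE (hv' i) (ha' i) (hb' i)
  rw [dorfmanC_swap hzs (hs (hv' i) (ha' i) (hb' i)) (Eventually.of_forall fun q =>
    D.Ψ.pairC_eq_zero (hz.2 q) (hvab' i q))]
  exact neg_mem (key i)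

end Forward

/-! ### From the summands to the sum -/

section Backward

variable {F : Type*} [NormedAddCommGroup F] [NormedSpace ℝ F] [FiniteDimensional ℝ F]
  {M : Type*} [TopologicalSpace M] [T2Space M] [ChartedSpace F M] [IsManifold 𝓘(ℝ, F) ∞ M]
  (D : MorimotoDatum F M) {p : M}

omit [FiniteDimensional ℝ F] [T2Space M] in
/-- Sections of `L_J` are sums of sections of `L_{J₁}`, `L_{J₂}` and `L_Ψ`; the projections onto
the summands are `-J₁²`, `-J₂²` and `-Ψ²`. -/
lemma exists_decomposition {z : (q : M) → CGT F q} (hz : z ∈ D.J.eigenSections) :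
    ∃ z₁ ∈ D.J₁.eigenSections, ∃ z₂ ∈ D.J₂.eigenSections, ∃ z₃ ∈ D.Ψ.eigenSections,
      ∀ q, z q = z₁ q + (z₂ q + z₃ q) := by
  have hx : IsSmoothOn ⊤ (fun q => reC (z q)) := hz.1.1.1
  -- the section of `L_K` with real part `-K² (Re z)`
  have key : ∀ {A : SplitStructure F M} (K : SGF A),
      (∀ q, K.toFun q (K.toFun q (reC (z q))) ∈ A.fiber q) →
      K.lift (fun q => -K.toFun q (K.toFun q (reC (z q)))) ∈ K.eigenSections := by
    intro A K hK
    have hs : IsSmoothOn ⊤ (fun q => K.toFun q (K.toFun q (reC (z q)))) :=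
      K.smooth ⊤ _ (K.smooth ⊤ _ hx)
    have hn : ∀ {y : (q : M) → GT F q}, IsSmoothOn ⊤ y → IsSmoothOn ⊤ (fun q => -y q) := by
      intro y hy
      have := IsSmoothOn.zero.sub hy
      rwa [zero_sub] at this
    refine ⟨⟨?_, ?_⟩, fun q => K.lift_mem (neg_mem (hK q))⟩
    · simp only [SGF.lift, reC_mkC]
      exact ⟨hn hs, fun _ _ => trivial, fun q hq => (hq trivial).elim⟩
    · simp only [SGF.lift, imC_mkC]
      exact ⟨hn (K.smooth ⊤ _ (hn hs)), fun _ _ => trivial, fun q hq => (hq trivial).elim⟩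
  have hdec : ∀ q, ∃ x ∈ D.E₁.fiber q, ∃ y ∈ D.E₂.fiber q, ∃ u ∈ D.E₁'.fiber q ⊔ D.E₂'.fiber q,
      reC (z q) = x + y + u := by
    intro q
    obtain ⟨xy, hxy, u, hu, h⟩ := Submodule.mem_sup.1 (D.J.mem_eigen.1 (hz.2 q)).1
    obtain ⟨x, hx, y, hy, rfl⟩ := Submodule.mem_sup.1 hxy
    exact ⟨x, hx, y, hy, u, hu, h.symm⟩
  choose x hx y hy u hu hxyu using hdec
  have hu1 : ∀ q, D.J₁.toFun q (u q) = 0 := fun q => by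
    obtain ⟨s, hs, t, ht, h⟩ := Submodule.mem_sup.1 (hu q)
    rw [← h, map_add, D.J₁_E₁' hs, D.J₁_E₂' ht, add_zero]
  have hu2 : ∀ q, D.J₂.toFun q (u q) = 0 := fun q => by
    obtain ⟨s, hs, t, ht, h⟩ := Submodule.mem_sup.1 (hu q)
    rw [← h, map_add, D.J₂_E₁' hs, D.J₂_E₂' ht, add_zero]
  have e1 : ∀ q, D.J₁.toFun q (D.J₁.toFun q (reC (z q))) = -x q := fun q => by
    simp only [hxyu, map_add, D.J₁_E₂ (hy q), hu1, add_zero, D.J₁.apply_apply (hx q)]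
  have e2 : ∀ q, D.J₂.toFun q (D.J₂.toFun q (reC (z q))) = -y q := fun q => by
    simp only [hxyu, map_add, D.J₂_E₁ (hx q), hu2, zero_add, add_zero, D.J₂.apply_apply (hy q)]
  have e3 : ∀ q, D.Ψ.toFun q (D.Ψ.toFun q (reC (z q))) = -u q := fun q => by
    simp only [hxyu, map_add, D.Ψ_E₁ (hx q), D.Ψ_E₂ (hy q), zero_add, D.Ψ.apply_apply (hu q)]
  refine ⟨_, key D.J₁ fun q => by rw [e1]; exact neg_mem (hx q),
    _, key D.J₂ fun q => by rw [e2]; exact neg_mem (hy q),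
    _, key D.Ψ fun q => by rw [e3]; exact neg_mem (hu q), fun q => ?_⟩
  have h2 := (D.J.mem_eigen.1 (hz.2 q)).2
  simp only [SGF.lift, e1, e2, e3, neg_neg]
  apply cgt_ext
  · simp only [map_add, reC_mkC, hxyu]
    abel
  · simp only [map_add, imC_mkC, h2, J_apply, hxyu, D.J₁_E₂ (hy q), hu1, D.J₂_E₁ (hx q), hu2,
      D.Ψ_E₁ (hx q), D.Ψ_E₂ (hy q)]
    abel

/-- Brackets of sections of `L_{J₁}` and `L_{J₂}` lie in `L_{J₁} ⊕ L_{J₂}`, if `E₁` and `E₂` have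
adapted framings. -/
lemma dorfmanC_mem_eigen_of_J₁_J₂ (h₁ : D.HasAdaptedFramings D.J₁ D.E₁'')
    (h₂ : D.HasAdaptedFramings D.J₂ D.E₂'') {z w : (q : M) → CGT F q}
    (hz : z ∈ D.J₁.eigenSections) (hw : w ∈ D.J₂.eigenSections) (p : M) :
    dorfmanC z w p ∈ D.J.eigen p := by
  have hzs := SGF.smoothNearC_of_mem hz p
  have hzJ : ∀ᶠ q in 𝓝 p, z q ∈ D.J₁.eigen q := Eventually.of_forall hz.2
  obtain ⟨ι, _, f, u, hf, hu, huE, hwu, hd⟩ := D.swap.exists_adapted_sum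
    ((D.hasAdaptedFramings_swap D.J₂ D.E₂'').2 h₂) (SGF.smoothNearC_of_mem hw p)
    (Eventually.of_forall hw.2)
  have hus : ∀ i, SmoothNearC p (fun q => mkC (u i q) 0) := fun i =>
    SmoothNearC.mk (hu i).smooth SmoothNear.zero
  rw [dorfmanC_congr (Eventually.of_forall fun _ => rfl) hwu,
    dorfmanC_sum_smul_right Finset.univ hzs (fun i _ => hf i) fun i _ => hus i]
  refine add_mem (sum_mem fun i _ => Submodule.smul_mem _ _ ?_)
    (D.eigen_J₂_le p (hd _ ⟨D.E₁_le p (D.J₁.eigen_le p (hz.2 p)).1,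
      D.E₁_le p (D.J₁.eigen_le p (hz.2 p)).2⟩))
  rw [dorfmanC_swap hzs (hus i)]
  · exact neg_mem (D.eigen_J₁_le p (D.dorfmanC_mem_eigen_J₁ h₁ (hu i).swap
      ((huE i).mono fun q h => D.E₂_le q h) hzs hzJ))
  · filter_upwards [huE i] with q hq
    refine pairC_eq_zero_of_orthogonal (D.orth₁₂ q) (D.J₁.eigen_le q (hz.2 q)) ?_
    rw [mem_cFiber, reC_mkC, imC_mkC]
    exact ⟨hq, zero_mem _⟩

/-- Brackets of sections of `L_{J₁}` and `L_Ψ` lie in `L_{J₁} ⊕ L_Ψ`, if `E₁` has adapted framings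
and `V₁` normalizes `L_{J₁}`. -/
lemma dorfmanC_mem_eigen_of_J₁_Ψ (h₁ : D.HasAdaptedFramings D.J₁ D.E₁'')
    (hV : ∀ v ∈ D.V₁, v ∈ D.J₁.normalizer) {z w : (q : M) → CGT F q}
    (hz : z ∈ D.J₁.eigenSections) (hw : w ∈ D.Ψ.eigenSections) (p : M) :
    dorfmanC z w p ∈ D.J.eigen p := by
  have hzs := SGF.smoothNearC_of_mem hz p
  have hzJ : ∀ᶠ q in 𝓝 p, z q ∈ D.J₁.eigen q := Eventually.of_forall hz.2
  obtain ⟨ι, _, f, v, a, b, hf, hv, ha, hb, hvab, hwv⟩ := D.exists_sum_graph hw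
  have hvs : ∀ i, SmoothNearC p (fun q => mkC (v i q) 0) := fun i =>
    D.smoothNearC_real (D.normalizes_V₁ (hv i) p)
  have has : ∀ i, SmoothNearC p (fun q => mkC (a i q) (b i q)) := fun i =>
    D.smoothNearC_mk (ha i) (hb i) p
  rw [dorfmanC_congr (Eventually.of_forall fun _ => rfl) (Eventually.of_forall hwv)]
  refine dorfmanC_sum_mem _ hzs (fun i => ⟨⊤, trivial, hf i⟩) (fun i => (hvs i).add (has i))
    (fun i => ?_) fun i => D.eigen_Ψ_le p (hvab i p)
  rw [dorfmanC_swap hzs ((hvs i).add (has i)) (Eventually.of_forall fun q => ?_),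
    dorfmanC_add_left (hvs i) (has i) hzs]
  · exact neg_mem (D.eigen_J₁_le p (add_mem
      (SGF.dorfmanC_mem_of_mem_normalizer (hV _ (hv i)) hzs hzJ)
      (D.dorfmanC_mem_eigen_J₁_of_V₂ h₁ (ha i) (hb i) hzs hzJ)))
  · have h1 := D.J₁.eigen_le q (hz.2 q)
    refine pairC_eq_zero_of_orthogonal (E' := D.E₁'.fiber q ⊔ D.E₂'.fiber q) ?_ h1
      (D.Ψ.eigen_le q (hvab i q))
    intro x hx y hy
    obtain ⟨s, hs, t, ht, rfl⟩ := Submodule.mem_sup.1 hy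
    rw [pair_add_right, D.orth₁₁' q x hx s hs, D.orth₁₂' q x hx t ht, add_zero]

/-- The normality of the two pairs makes the local framings adapted, so that all nine brackets
between `L_{J₁}`, `L_{J₂}` and `L_Ψ` lie in `L_J`. -/
lemma isCRF_of_isNormalPair (h₁ : IsNormalPair D.J₁ D.E₁' D.V₁) (h₂ : IsNormalPair D.J₂ D.E₂' D.V₂)
    (hΨ : D.Ψ.IsCRF) : D.J.IsCRF := by
  have a₁ := D.hasAdaptedFramings_of_isCRF h₁.isCRF
  have a₂' : D.swap.HasAdaptedFramings D.swap.J₁ D.swap.E₁'' :=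
    D.swap.hasAdaptedFramings_of_isCRF h₂.isCRF
  have a₂ := (D.hasAdaptedFramings_swap D.J₂ D.E₂'').1 a₂'
  intro z hz w hw p
  obtain ⟨z₁, hz₁, z₂, hz₂, z₃, hz₃, hz⟩ := D.exists_decomposition hz
  obtain ⟨w₁, hw₁, w₂, hw₂, w₃, hw₃, hw⟩ := D.exists_decomposition hw
  have hΨs : D.swap.Ψ.eigenSections = D.Ψ.eigenSections :=
    SGF.eigenSections_congr D.swap_Ψ_eigenFiber
  have hJs : ∀ l, l ∈ D.swap.J.eigen p → l ∈ D.J.eigen p := fun l hl => by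
    change l ∈ D.swap.J.eigenFiber p at hl
    rwa [swap_J_eigenFiber] at hl
  have hV₁ : ∀ v ∈ D.V₁, v ∈ D.J₁.normalizer := fun v hv => (h₁.normalizes hv).1
  have hV₂ : ∀ v ∈ D.V₂, v ∈ D.J₂.normalizer := fun v hv => (h₂.normalizes hv).1
  have c12 := fun {z w : (q : M) → CGT F q} (hz : z ∈ D.J₁.eigenSections)
    (hw : w ∈ D.J₂.eigenSections) => D.dorfmanC_mem_eigen_of_J₁_J₂ a₁ a₂ hz hw p
  have c13 := fun {z w : (q : M) → CGT F q} (hz : z ∈ D.J₁.eigenSections)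
    (hw : w ∈ D.Ψ.eigenSections) => D.dorfmanC_mem_eigen_of_J₁_Ψ a₁ hV₁ hz hw p
  have c23 := fun {z w : (q : M) → CGT F q} (hz : z ∈ D.J₂.eigenSections)
    (hw : w ∈ D.Ψ.eigenSections) => hJs _ (D.swap.dorfmanC_mem_eigen_of_J₁_Ψ a₂' hV₂ hz
      (hΨs ▸ hw) p)
  -- the remaining brackets follow by skew-symmetry
  have hsw : ∀ {A B : SplitStructure F M} {K : SGF A} {L : SGF B} {z w : (q : M) → CGT F q},
      z ∈ K.eigenSections → w ∈ L.eigenSections → (∀ q, K.eigen q ≤ D.J.eigen q) →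
      (∀ q, L.eigen q ≤ D.J.eigen q) → dorfmanC w z p ∈ D.J.eigen p →
      dorfmanC z w p ∈ D.J.eigen p := by
    intro A B K L z w hz hw hK hL h
    rw [dorfmanC_swap (SGF.smoothNearC_of_mem hz p) (SGF.smoothNearC_of_mem hw p)
      (Eventually.of_forall fun q => D.J.pairC_eq_zero (hK q (hz.2 q)) (hL q (hw.2 q)))]
    exact neg_mem h
  have s₁ := SGF.smoothNearC_of_mem hz₁ p
  have s₂ := SGF.smoothNearC_of_mem hz₂ p
  have s₃ := SGF.smoothNearC_of_mem hz₃ p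
  have t₁ := SGF.smoothNearC_of_mem hw₁ p
  have t₂ := SGF.smoothNearC_of_mem hw₂ p
  have t₃ := SGF.smoothNearC_of_mem hw₃ p
  change dorfmanC z w p ∈ D.J.eigen p
  rw [dorfmanC_congr (Eventually.of_forall hz) (Eventually.of_forall hw),
    dorfmanC_add_left s₁ (s₂.add s₃) (t₁.add (t₂.add t₃)),
    dorfmanC_add_left s₂ s₃ (t₁.add (t₂.add t₃)), dorfmanC_add_right s₁ t₁ (t₂.add t₃),
    dorfmanC_add_right s₁ t₂ t₃, dorfmanC_add_right s₂ t₁ (t₂.add t₃),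
    dorfmanC_add_right s₂ t₂ t₃, dorfmanC_add_right s₃ t₁ (t₂.add t₃),
    dorfmanC_add_right s₃ t₂ t₃]
  refine add_mem (add_mem ?_ (add_mem ?_ ?_)) (add_mem (add_mem ?_ (add_mem ?_ ?_))
    (add_mem ?_ (add_mem ?_ ?_)))
  · exact D.eigen_J₁_le p (h₁.isCRF z₁ hz₁ w₁ hw₁ p)
  · exact c12 hz₁ hw₂
  · exact c13 hz₁ hw₃
  · exact hsw hz₂ hw₁ D.eigen_J₂_le D.eigen_J₁_le (c12 hw₁ hz₂)
  · exact D.eigen_J₂_le p (h₂.isCRF z₂ hz₂ w₂ hw₂ p)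
  · exact c23 hz₂ hw₃
  · exact hsw hz₃ hw₁ D.eigen_Ψ_le D.eigen_J₁_le (c13 hw₁ hz₃)
  · exact hsw hz₃ hw₂ D.eigen_Ψ_le D.eigen_J₂_le (c23 hw₂ hz₃)
  · exact D.eigen_Ψ_le p (hΨ z₃ hz₃ w₃ hw₃ p)

end Backward
end MorimotoDatum
end GenGeom

end

theorem mainTheorem1 {F : Type*} [NormedAddCommGroup F] [NormedSpace ℝ F] [FiniteDimensional ℝ F]
    {M : Type*} [TopologicalSpace M] [T2Space M] [SecondCountableTopology M]
    [ChartedSpace F M] [IsManifold 𝓘(ℝ, F) ∞ M] (D : GenGeom.MorimotoDatum F M) :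
    (D.J.IsCRF ∧ D.IsAdaptable) ↔
      (GenGeom.IsNormalPair D.J₁ D.E₁' D.V₁ ∧ GenGeom.IsNormalPair D.J₂ D.E₂' D.V₂ ∧
        D.Ψ.IsCRF) := by
  constructor
  · rintro ⟨hJ, h₁, h₂⟩
    have hJ' : D.swap.J.IsCRF := (GenGeom.SGF.isCRF_congr D.swap_J_eigenFiber).2 hJ
    exact ⟨D.isNormalPair_of_isCRF hJ h₁,
      D.swap.isNormalPair_of_isCRF hJ' ((D.hasAdaptedFramings_swap D.J₂ D.E₂'').2 h₂),
      D.isCRF_Ψ hJ⟩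
  · rintro ⟨h₁, h₂, hΨ⟩
    exact ⟨D.isCRF_of_isNormalPair h₁ h₂ hΨ, D.hasAdaptedFramings_of_isCRF h₁.isCRF,
      (D.hasAdaptedFramings_swap D.J₂ D.E₂'').1 (D.swap.hasAdaptedFramings_of_isCRF h₂.isCRF)⟩
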